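/- **Setting.** Modal formulas are built from proposition symbols $p_0,p_1,\dots$ and $\bot$ (the atomic formulas) with $\land,\lor,\to,\Box,\Diamond$. Positions $\alpha,\beta,\gamma,\dots$ are finite sequences over a denumerable set of tokens $x,y,\dots$; juxtaposition is concatenation. A position-formula $A^\alpha$ is a modal formula $A$ with a position $\alpha$. For a set $\Gamma$ of assumptions, $\mathrm{Init}(\Gamma)$ is the set of prefixes of positions of members of $\Gamma$. **Systems.** The intuitionistic natural deduction systems $N^i_T,N^i_D,N^i_{D4},N^i_{S4}$ have the following rules (discharged assumptions in brackets; a rule may discharge any number of occurrences, possibly none): * ($\land I$) from $A^\alpha$ and $B^\alpha$ infer $(A\land B)^\alpha$; ($\land E$) from $(A\land B)^\alpha$ infer $A^\alpha$, respectively $B^\alpha$; * ($\lor I$) from $A^\alpha$, or from $B^\alpha$, infer $(A\lor B)^\alpha$; ($\lor E$) from $(A\lor B)^\alpha$, a deduction of $C^\beta$ from $[A^\alpha]$ and a deduction of $C^\beta$ from $[B^\alpha]$, infer $C^\beta$; * ($\to I$) from a deduction of $B^\alpha$ from $[A^\alpha]$ infer $(A\to B)^\alpha$; ($\to E$) from $(A\to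 B)^\alpha$ and $A^\alpha$ infer $B^\alpha$; * ($\bot_i$) from $\bot^\beta$ infer $A^\alpha$, where $A$ is atomic and, if $A=\bot$, $\alpha\neq\beta$; * ($\Box I$) from $A^{\alpha x}$ infer $\Box A^\alpha$, provided $\alpha x\notin \mathrm{Init}(\Gamma)$ for the set $\Gamma$ of open assumptions on which $A^{\alpha x}$ depends; ($\Box E$) from $\Box A^\alpha$ infer $A^{\alpha\beta}$; * ($\Diamond I$) from $A^{\alpha\beta}$ infer $\Diamond A^\alpha$; ($\Diamond E$) from $\Diamond A^\alpha$ and a deduction of $C^\gamma$ from $[A^{\alpha x}]$ infer $C^\gamma$, provided $\alpha x$ is not a prefix of $\gamma$ and $\alpha x\notin\mathrm{Init}(\Gamma)$ for the set $\Gamma$ of assumptions, other than the discharged ones, on which the minor premiss $C^\gamma$ depends. In $\Box E$ and $\Diamond I$ the sequence $\beta$ is: empty for $T$; of length $1$ for $D$; non-empty for $D4$; arbitrary for $S4$. The systems $N^i_K$ and $N^i_{K4}$ have in addition existence formulas $E(\alpha)$, used only as assumptions: $\Box E$ and $\Diamond I$ take the additional premiss $E(\alpha\beta)$, with $\beta$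 of length $1$ for $K$ and non-empty for $K4$; $\Box I$ and $\Diamond E$ also discharge $E(\alpha x)$; all other open existence assumptions count as members of $\Gamma$ in the side conditions. The position $\alpha x$ in $\Box I$, $\Diamond E$ is the proper position of the rule. **Reduction.** $\Pi[\delta/\varepsilon]$ is $\Pi$ with every position $\delta\tau$ replaced by $\varepsilon\tau$. In this operation, and whenever deductions are put into one another, proper positions are first renamed by new ones so that no clash arises, and an application of $\bot_i$ whose premiss and conclusion have become equal is deleted. Contractibility $\rhd$ consists of the proper contractions * $\land E_i(\land I(\Pi_1,\Pi_2))\rhd\Pi_i$; * $\lor E(\lor I_i(\Pi),\Pi_1,\Pi_2)\rhd\Pi_i$ with $\Pi$ put above the discharged assumptions of $\Pi_i$; * $\to E(\to I(\Pi_1),\Pi_2)\rhd\Pi_1$ with $\Pi_2$ put above the discharged assumptions of $\Pi_1$; * $\Box E(\Box I(\Pi))$, with conclusion $A^{\alpha\beta}$ and proper position $\alpha x$, $\rhd\ \Pi[\alpha x/\alpha\beta]$; * $\Diamond E(\Diamond I(\Pi_1),\Pi_2)$, where $\Pi_1$ ends in $A^{\alpha\beta}$ and the proper position is $\alpha x$,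 $\rhd\ \Pi_2[\alpha x/\alpha\beta]$ with $\Pi_1$ put above the discharged assumptions $A^{\alpha\beta}$ (in $K$ and $K4$ the discharged leaves $E(\alpha x)$ thereby become $E(\alpha\beta)$), and of the commutative contractions, for every application $R[\cdot]$ of an elimination rule ($\land E$, $\lor E$, $\to E$, $\Box E$ or $\Diamond E$) to a major premiss: * $R[\lor E(\Pi_1,\Pi_2,\Pi_3)]\rhd\lor E(\Pi_1,R[\Pi_2],R[\Pi_3])$; * $R[\Diamond E(\Pi_1,\Pi_2)]\rhd\Diamond E(\Pi_1,R[\Pi_2])$. $\Pi\succ\Pi'$ means that $\Pi'$ arises from $\Pi$ by replacing one sub-deduction by a contractum of it, and $\succ^*$ is the reflexive and transitive closure of $\succ$. A deduction $\Pi$ is in normal form if there is no $\Pi'$ with $\Pi\succ\Pi'$. **Theorem (normalization).** Let $N$ be one of $N^i_K,N^i_T,N^i_D,N^i_{K4},N^i_{D4},N^i_{S4}$. For every deduction $\Pi$ in $N$ (with arbitrary open assumptions and conclusion) there is a deduction $\Pi'$ in $N$, of the same conclusion and from the same assumptions (not all of which need be used), such that $\Pi\succ^*\Pi'$ and $\Pi'$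 is in normal form. -/

import Mathlib

namespace PosND

/-! ### Modal formulas, positions, position-formulas -/

/-- Propositional modal formulas over countably many proposition symbols. -/
inductive Fml : Type
  | prop (k : ℕ)
  | bot
  | and (A B : Fml)
  | or (A B : Fml)
  | imp (A B : Fml)
  | box (A : Fml)
  | dia (A : Fml)
  deriving DecidableEq

/-- Atomic formulas: proposition symbols and `⊥`. -/
inductive Fml.IsAtomic : Fml → Prop
  | prop (k : ℕ) : Fml.IsAtomic (.prop k)
  | bot : Fml.IsAtomic .bot

/-- Positions: finite sequences of tokens; the denumerable set of tokens is `ℕ`.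
`α ++ β` is concatenation and `α <+: β` says that `α` is a prefix of `β`. -/
abbrev Pos : Type := List ℕ

/-- The position `α x`. -/
abbrev Pos.snoc (α : Pos) (x : ℕ) : Pos := α ++ [x]

/-- The position map that sends every `u t` to `v t` and agrees with `f` elsewhere.
For `f = id` this is prefix replacement `s ↦ s[u/v]`. -/
def Pos.update (f : Pos → Pos) (u v : Pos) : Pos → Pos :=
  fun s => if u <+: s then v ++ s.drop u.length else f s

/-- Prefix replacement: `s[u/v]` is `v t` if `s = u t`, and `s` otherwise. -/
abbrev Pos.replace (u v : Pos) : Pos → Pos := Pos.update id u v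

/-- A number exceeding every token of the position. -/
def Pos.bound (α : Pos) : ℕ := α.foldr (fun x m => max (x + 1) m) 0

/-- A position-formula `A^α`. -/
structure PForm : Type where
  fml : Fml
  pos : Pos
  deriving DecidableEq

/-! ### The six systems -/

/-- The names of the intuitionistic systems. -/
inductive System : Type
  | K | D | T | K4 | D4 | S4
  deriving DecidableEq

/-- The partial systems, whose modal rules use existence formulas `E(α)`. -/
def System.IsPartial : System → Prop
  | .K => True
  | .K4 => True
  | _ => False

/-- The constraint which the system puts on `β` in the rules `□E` (from `□A^α` infer `A^{αβ}`)
and `◇I` (from `A^{αβ}` infer `◇A^α`). -/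
def System.Constraint : System → Pos → Prop
  | .K, β => β.length = 1
  | .D, β => β.length = 1
  | .T, β => β = []
  | .K4, β => β ≠ []
  | .D4, β => β ≠ []
  | .S4, _ => True

/-! ### Derivation trees

A tree records the last rule, the immediate sub-trees, and the labels that these do not determine.

* Assumption leaves `A^α` carry a de Bruijn index: a rule that discharges a formula binds index `0`
  in the premiss concerned (and may bind no occurrence at all), and every discharge lowers the
  other indices by one. Indices that no rule binds name the open assumptions.
* In the partial systems the rules `□E` and `◇I` have a second premiss `E(αβ)`, which is always an
  assumption. The nodes `boxE ε t` and `diaI α ε t` stand for the rule together with that leaf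
  `E(ε)`. The rules `□I` and `◇E` with proper position `αx` discharge the leaves `E(αx)` that are
  open above them; their side condition allows no such leaf to remain open, so no label is
  needed for these discharges. In the total systems there are no such leaves. -/

/-- Trees of rule applications, before the rules are checked. -/
inductive Tree : Type
  /-- An assumption `a`. -/
  | hyp (i : ℕ) (a : PForm)
  | andI (t u : Tree)
  | andE1 (t : Tree)
  | andE2 (t : Tree)
  /-- From `A^α` infer `(A ∨ B)^α`; the label is `B`. -/
  | orI1 (B : Fml) (t : Tree)
  /-- From `B^α` infer `(A ∨ B)^α`; the label is `A`. -/
  | orI2 (A : Fml) (t : Tree)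
  /-- From `(A ∨ B)^α`, `C^β` and `C^β` infer `C^β`, discharging `A^α` in `u` and `B^α` in `v`. -/
  | orE (t u v : Tree)
  /-- From `B^α` infer `(A → B)^α`, discharging `A^α`; the label is `A`. -/
  | impI (A : Fml) (t : Tree)
  | impE (t u : Tree)
  /-- From `⊥^β` infer `A^α`. -/
  | botI (β : Pos) (A : Fml) (α : Pos) (t : Tree)
  /-- From `A^{αx}` infer `□A^α`; the proper position is `αx`. -/
  | boxI (α : Pos) (x : ℕ) (t : Tree)
  /-- From `□A^α` infer `A^ε`. -/
  | boxE (ε : Pos) (t : Tree)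
  /-- From `A^ε` infer `◇A^α`. -/
  | diaI (α ε : Pos) (t : Tree)
  /-- From `◇A^α` and `C^β` infer `C^β`, discharging `A^{αx}` in `u`; the proper position
  is `αx`. -/
  | diaE (α : Pos) (x : ℕ) (t u : Tree)

/-- The effect of one discharge on the list of open assumption leaves of a premiss: leaves with
index `0` are discharged, the other indices are lowered by one. -/
def discharge (l : List (ℕ × PForm)) : List (ℕ × PForm) :=
  (l.filter fun p => p.1 ≠ 0).map fun p => (p.1 - 1, p.2)

/-- The open assumption leaves (position-formulas) of a tree. -/
def Tree.opens : Tree → List (ℕ × PForm)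
  | .hyp i a => [(i, a)]
  | .andI t u => t.opens ++ u.opens
  | .andE1 t => t.opens
  | .andE2 t => t.opens
  | .orI1 _ t => t.opens
  | .orI2 _ t => t.opens
  | .orE t u v => t.opens ++ discharge u.opens ++ discharge v.opens
  | .impI _ t => discharge t.opens
  | .impE t u => t.opens ++ u.opens
  | .botI _ _ _ t => t.opens
  | .boxI _ _ t => t.opens
  | .boxE _ t => t.opens
  | .diaI _ _ t => t.opens
  | .diaE _ _ t u => t.opens ++ discharge u.opens

/-- The positions `ε` of the open leaves `E(ε)` of a tree (relevant in the partial systems). -/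
def Tree.exts : Tree → List Pos
  | .hyp _ _ => []
  | .andI t u => t.exts ++ u.exts
  | .andE1 t => t.exts
  | .andE2 t => t.exts
  | .orI1 _ t => t.exts
  | .orI2 _ t => t.exts
  | .orE t u v => t.exts ++ u.exts ++ v.exts
  | .impI _ t => t.exts
  | .impE t u => t.exts ++ u.exts
  | .botI _ _ _ t => t.exts
  | .boxI α x t => t.exts.filter fun ε => ε ≠ α.snoc x
  | .boxE ε t => ε :: t.exts
  | .diaI _ ε t => ε :: t.exts
  | .diaE α x t u => t.exts ++ u.exts.filter fun ε => ε ≠ α.snoc x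

/-- `π` is not a prefix of the position of any assumption in `l`. -/
def NotInit (π : Pos) (l : List (ℕ × PForm)) : Prop :=
  ∀ p ∈ l, ¬ π <+: p.2.pos

/-- In a partial system, `π` is not a prefix of the position of any existence assumption in `l`
other than `E(π)` itself. -/
def NotInitExt (S : System) (π : Pos) (l : List Pos) : Prop :=
  S.IsPartial → ∀ ε ∈ l, ε ≠ π → ¬ π <+: ε

/-- `IsDeduction S Γ Ξ t a`: the tree `t` is a deduction of `a` in the system `S` whose open
assumptions are among the position-formulas in `Γ` (the leaf with index `i` being the `i`-th member
of `Γ`) and, if `S` is partial, the existence formulas `E(ε)` with `ε` in `Ξ`. -/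
inductive IsDeduction (S : System) : List PForm → List Pos → Tree → PForm → Prop
  | hyp {Γ Ξ i a} :
      Γ[i]? = some a → IsDeduction S Γ Ξ (.hyp i a) a
  | andI {Γ Ξ t u A B α} :
      IsDeduction S Γ Ξ t ⟨A, α⟩ → IsDeduction S Γ Ξ u ⟨B, α⟩ →
      IsDeduction S Γ Ξ (.andI t u) ⟨.and A B, α⟩
  | andE1 {Γ Ξ t A B α} :
      IsDeduction S Γ Ξ t ⟨.and A B, α⟩ → IsDeduction S Γ Ξ (.andE1 t) ⟨A, α⟩
  | andE2 {Γ Ξ t A B α} :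
      IsDeduction S Γ Ξ t ⟨.and A B, α⟩ → IsDeduction S Γ Ξ (.andE2 t) ⟨B, α⟩
  | orI1 {Γ Ξ t A B α} :
      IsDeduction S Γ Ξ t ⟨A, α⟩ → IsDeduction S Γ Ξ (.orI1 B t) ⟨.or A B, α⟩
  | orI2 {Γ Ξ t A B α} :
      IsDeduction S Γ Ξ t ⟨B, α⟩ → IsDeduction S Γ Ξ (.orI2 A t) ⟨.or A B, α⟩
  | orE {Γ Ξ t u v A B α C β} :
      IsDeduction S Γ Ξ t ⟨.or A B, α⟩ →
      IsDeduction S (⟨A, α⟩ :: Γ) Ξ u ⟨C, β⟩ →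
      IsDeduction S (⟨B, α⟩ :: Γ) Ξ v ⟨C, β⟩ →
      IsDeduction S Γ Ξ (.orE t u v) ⟨C, β⟩
  | impI {Γ Ξ t A B α} :
      IsDeduction S (⟨A, α⟩ :: Γ) Ξ t ⟨B, α⟩ → IsDeduction S Γ Ξ (.impI A t) ⟨.imp A B, α⟩
  | impE {Γ Ξ t u A B α} :
      IsDeduction S Γ Ξ t ⟨.imp A B, α⟩ → IsDeduction S Γ Ξ u ⟨A, α⟩ →
      IsDeduction S Γ Ξ (.impE t u) ⟨B, α⟩
  | botI {Γ Ξ t β A α} :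
      IsDeduction S Γ Ξ t ⟨.bot, β⟩ → A.IsAtomic → (A = .bot → α ≠ β) →
      IsDeduction S Γ Ξ (.botI β A α t) ⟨A, α⟩
  | boxI {Γ Ξ t A α x} :
      IsDeduction S Γ (α.snoc x :: Ξ) t ⟨A, α.snoc x⟩ →
      NotInit (α.snoc x) t.opens → NotInitExt S (α.snoc x) t.exts →
      IsDeduction S Γ Ξ (.boxI α x t) ⟨.box A, α⟩
  | boxE {Γ Ξ t A α β ε} :
      IsDeduction S Γ Ξ t ⟨.box A, α⟩ → ε = α ++ β → S.Constraint β → (S.IsPartial → ε ∈ Ξ) →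
      IsDeduction S Γ Ξ (.boxE ε t) ⟨A, ε⟩
  | diaI {Γ Ξ t A α β ε} :
      IsDeduction S Γ Ξ t ⟨A, ε⟩ → ε = α ++ β → S.Constraint β → (S.IsPartial → ε ∈ Ξ) →
      IsDeduction S Γ Ξ (.diaI α ε t) ⟨.dia A, α⟩
  | diaE {Γ Ξ t u A α x C γ} :
      IsDeduction S Γ Ξ t ⟨.dia A, α⟩ →
      IsDeduction S (⟨A, α.snoc x⟩ :: Γ) (α.snoc x :: Ξ) u ⟨C, γ⟩ →
      ¬ α.snoc x <+: γ →
      NotInit (α.snoc x) (discharge u.opens) → NotInitExt S (α.snoc x) u.exts →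
      IsDeduction S Γ Ξ (.diaE α x t u) ⟨C, γ⟩

/-- The deductions of `a` from `Γ` and `Ξ` in the system `S`. -/
def Deduction (S : System) (Γ : List PForm) (Ξ : List Pos) (a : PForm) : Type :=
  {t : Tree // IsDeduction S Γ Ξ t a}

/-! ### Substitution -/

/-- A number exceeding every token that occurs in the tree. -/
def Tree.bound : Tree → ℕ
  | .hyp _ a => a.pos.bound
  | .andI t u => max t.bound u.bound
  | .andE1 t => t.bound
  | .andE2 t => t.bound
  | .orI1 _ t => t.bound
  | .orI2 _ t => t.bound
  | .orE t u v => max t.bound (max u.bound v.bound)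
  | .impI _ t => t.bound
  | .impE t u => max t.bound u.bound
  | .botI β _ α t => max β.bound (max α.bound t.bound)
  | .boxI α x t => max (α.snoc x).bound t.bound
  | .boxE ε t => max ε.bound t.bound
  | .diaI α ε t => max α.bound (max ε.bound t.bound)
  | .diaE α x t u => max (α.snoc x).bound (max t.bound u.bound)

/-- Extend a renaming of indices over a discharge. -/
def liftRen (r : ℕ → ℕ) : ℕ → ℕ
  | 0 => 0
  | i + 1 => r i + 1

/-- Rename the indices of the open assumptions. -/
def Tree.rename (r : ℕ → ℕ) : Tree → Tree
  | .hyp i a => .hyp (r i) a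
  | .andI t u => .andI (t.rename r) (u.rename r)
  | .andE1 t => .andE1 (t.rename r)
  | .andE2 t => .andE2 (t.rename r)
  | .orI1 B t => .orI1 B (t.rename r)
  | .orI2 A t => .orI2 A (t.rename r)
  | .orE t u v => .orE (t.rename r) (u.rename (liftRen r)) (v.rename (liftRen r))
  | .impI A t => .impI A (t.rename (liftRen r))
  | .impE t u => .impE (t.rename r) (u.rename r)
  | .botI β A α t => .botI β A α (t.rename r)
  | .boxI α x t => .boxI α x (t.rename r)
  | .boxE ε t => .boxE ε (t.rename r)
  | .diaI α ε t => .diaI α ε (t.rename r)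
  | .diaE α x t u => .diaE α x (t.rename r) (u.rename (liftRen r))

/-- Extend a substitution for open assumptions over a discharge. -/
def liftSub (σ : ℕ → PForm → Tree) : ℕ → PForm → Tree
  | 0, a => .hyp 0 a
  | i + 1, a => (σ i a).rename Nat.succ

/-- `t.subst n f σ` is the simultaneous replacement in `t` of every position `s` by `f s` and of
every open assumption leaf by the tree that `σ` assigns to it. Along the way every proper position
is renamed with a new token: `n` has to exceed all tokens in play. Applications of `⊥_i` whose
premiss and conclusion become equal are deleted. -/
def Tree.subst (n : ℕ) (f : Pos → Pos) (σ : ℕ → PForm → Tree) : Tree → Tree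
  | .hyp i a => σ i ⟨a.fml, f a.pos⟩
  | .andI t u => .andI (t.subst n f σ) (u.subst n f σ)
  | .andE1 t => .andE1 (t.subst n f σ)
  | .andE2 t => .andE2 (t.subst n f σ)
  | .orI1 B t => .orI1 B (t.subst n f σ)
  | .orI2 A t => .orI2 A (t.subst n f σ)
  | .orE t u v => .orE (t.subst n f σ) (u.subst n f (liftSub σ)) (v.subst n f (liftSub σ))
  | .impI A t => .impI A (t.subst n f (liftSub σ))
  | .impE t u => .impE (t.subst n f σ) (u.subst n f σ)
  | .botI β A α t =>
      if A = .bot ∧ f α = f β then t.subst n f σ else .botI (f β) A (f α) (t.subst n f σ)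
  | .boxI α x t =>
      .boxI (f α) n (t.subst (n + 1) (Pos.update f (α.snoc x) ((f α).snoc n)) σ)
  | .boxE ε t => .boxE (f ε) (t.subst n f σ)
  | .diaI α ε t => .diaI (f α) (f ε) (t.subst n f σ)
  | .diaE α x t u =>
      .diaE (f α) n (t.subst n f σ)
        (u.subst (n + 1) (Pos.update f (α.snoc x) ((f α).snoc n)) (liftSub σ))

/-- The substitution that puts `t` for the assumption with index `0`, which disappears. -/
def single (t : Tree) : ℕ → PForm → Tree
  | 0, _ => t
  | i + 1, a => .hyp i a

/-! ### Contractions -/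

/-- An application of an elimination rule, without its major premiss. -/
inductive Elim : Type
  | andE1
  | andE2
  | orE (u v : Tree)
  | impE (u : Tree)
  | boxE (ε : Pos)
  | diaE (α : Pos) (x : ℕ) (u : Tree)

/-- The tree that ends with the elimination `R` and has `t` above its major premiss. -/
def Elim.apply : Elim → Tree → Tree
  | .andE1, t => .andE1 t
  | .andE2, t => .andE2 t
  | .orE u v, t => .orE t u v
  | .impE u, t => .impE t u
  | .boxE ε, t => .boxE ε t
  | .diaE α x u, t => .diaE α x t u

/-- Raise the indices of all open assumptions above the minor premisses of `R` by one. -/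
def Elim.raise : Elim → Elim
  | .andE1 => .andE1
  | .andE2 => .andE2
  | .orE u v => .orE (u.rename (liftRen Nat.succ)) (v.rename (liftRen Nat.succ))
  | .impE u => .impE (u.rename Nat.succ)
  | .boxE ε => .boxE ε
  | .diaE α x u => .diaE α x (u.rename (liftRen Nat.succ))

/-- Contractibility: the proper contractions, followed by the two commutative contractions.
In the contraction of `◇E` against `R` the proper position `αx` is renamed to `αn` with a new token
`n`, so that it does not occur in `R`. -/
inductive Contracts : Tree → Tree → Prop
  | and1 (t u : Tree) : Contracts (.andE1 (.andI t u)) t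
  | and2 (t u : Tree) : Contracts (.andE2 (.andI t u)) u
  | or1 (B : Fml) (t u v : Tree) :
      Contracts (.orE (.orI1 B t) u v)
        (u.subst (Tree.orE (.orI1 B t) u v).bound id (single t))
  | or2 (A : Fml) (t u v : Tree) :
      Contracts (.orE (.orI2 A t) u v)
        (v.subst (Tree.orE (.orI2 A t) u v).bound id (single t))
  | imp (A : Fml) (t u : Tree) :
      Contracts (.impE (.impI A t) u)
        (t.subst (Tree.impE (.impI A t) u).bound id (single u))
  | box (α : Pos) (x : ℕ) (ε : Pos) (t : Tree) :
      Contracts (.boxE ε (.boxI α x t))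
        (t.subst (Tree.boxE ε (.boxI α x t)).bound (Pos.replace (α.snoc x) ε) .hyp)
  | dia (α : Pos) (x : ℕ) (ε : Pos) (t u : Tree) :
      Contracts (.diaE α x (.diaI α ε t) u)
        (u.subst (Tree.diaE α x (.diaI α ε t) u).bound (Pos.replace (α.snoc x) ε) (single t))
  | commOr (t u v : Tree) (R : Elim) :
      Contracts (R.apply (.orE t u v)) (.orE t (R.raise.apply u) (R.raise.apply v))
  | commDia (α : Pos) (x : ℕ) (t u : Tree) (R : Elim) (n : ℕ) :
      n = (R.apply (.diaE α x t u)).bound →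
      Contracts (R.apply (.diaE α x t u))
        (.diaE α n t
          (R.raise.apply (u.subst (n + 1) (Pos.replace (α.snoc x) (α.snoc n)) .hyp)))

/-- Immediate reducibility of trees: one subtree is replaced by a contractum of it. -/
inductive Step : Tree → Tree → Prop
  | contract {t t'} : Contracts t t' → Step t t'
  | andI_left {t t' u} : Step t t' → Step (.andI t u) (.andI t' u)
  | andI_right {t u u'} : Step u u' → Step (.andI t u) (.andI t u')
  | andE1 {t t'} : Step t t' → Step (.andE1 t) (.andE1 t')
  | andE2 {t t'} : Step t t' → Step (.andE2 t) (.andE2 t')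
  | orI1 {B t t'} : Step t t' → Step (.orI1 B t) (.orI1 B t')
  | orI2 {A t t'} : Step t t' → Step (.orI2 A t) (.orI2 A t')
  | orE_major {t t' u v} : Step t t' → Step (.orE t u v) (.orE t' u v)
  | orE_left {t u u' v} : Step u u' → Step (.orE t u v) (.orE t u' v)
  | orE_right {t u v v'} : Step v v' → Step (.orE t u v) (.orE t u v')
  | impI {A t t'} : Step t t' → Step (.impI A t) (.impI A t')
  | impE_major {t t' u} : Step t t' → Step (.impE t u) (.impE t' u)
  | impE_minor {t u u'} : Step u u' → Step (.impE t u) (.impE t u')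
  | botI {β A α t t'} : Step t t' → Step (.botI β A α t) (.botI β A α t')
  | boxI {α x t t'} : Step t t' → Step (.boxI α x t) (.boxI α x t')
  | boxE {ε t t'} : Step t t' → Step (.boxE ε t) (.boxE ε t')
  | diaI {α ε t t'} : Step t t' → Step (.diaI α ε t) (.diaI α ε t')
  | diaE_major {α x t t' u} : Step t t' → Step (.diaE α x t u) (.diaE α x t' u)
  | diaE_minor {α x t u u'} : Step u u' → Step (.diaE α x t u) (.diaE α x t u')

section
variable {S : System} {Γ : List PForm} {Ξ : List Pos} {a : PForm}

/-- Immediate reducibility between deductions. -/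
def Deduction.Red (P Q : Deduction S Γ Ξ a) : Prop := Step P.1 Q.1

/-- Reducibility between deductions: the reflexive and transitive closure. -/
def Deduction.Reduces : Deduction S Γ Ξ a → Deduction S Γ Ξ a → Prop :=
  Relation.ReflTransGen Deduction.Red

/-- A deduction is in normal form if it reduces immediately to nothing at all: no contraction
applies to any of its subtrees. -/
def Deduction.IsNormal (P : Deduction S Γ Ξ a) : Prop := ∀ t : Tree, ¬ Step P.1 t

end

end PosND

/-!
Normalization is proved by hereditary substitution. Two facts are kept apart.

*Termination* needs neither positions nor side conditions. Trees are typed by formulas alone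
(`Typed`), and a tree is normal if every major premiss is *neutral*: an assumption, or the conclusion
of `∧E`, `→E` or `□E` (`Tree.NF`). By induction on `d`, every elimination applied to a normal tree
whose formula has degree less than `d` normalizes (`ElimNormalizes`). If this holds for `d`, then a
normal tree still normalizes after normal trees of degree less than `d` are put for its assumptions
(`ElimNormalizes.subst`): going down the tree, a cut arises only where the assumption at the head of
a neutral major premiss is replaced, and then the cut formula is a part of the formula of that
assumption. Hence cuts of degree `d` normalize too (`ElimNormalizes.succ`), by induction on the size
of the major premiss: the commutative contractions move the elimination to smaller trees, and the
proper contractions lead to a substitution for an assumption of smaller degree, or to one of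
positions only, which creates no cut. An induction on trees then gives `Typed.normalizes`. Since
both trees are normalized before the substitution is made, it is never necessary to know that
reduction commutes with substitution, which fails for the chosen names of proper positions.

*Subject reduction* is where positions matter: a reduction step turns a deduction into a deduction
of the same conclusion, with no additional open assumptions (`LooseStep.refines`). The core is
`IsDeduction.subst`: the position maps that occur preserve the relation between `α` and `αβ` that the
system imposes on `□E` and `◇I` (`Respects`), and the side conditions hold after the substitution
because all proper positions are renamed by tokens beyond those of the open assumptions.
-/

namespace PosND

/-! ### Normal trees -/

/-- Contractibility, where the contraction of `◇I` against `◇E` does not require that the two rules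
name the same position. In deductions they always do. Without this requirement normalization
can be proved for trees that are typed with the positions left out. -/
inductive LooseContracts : Tree → Tree → Prop
  | of {t t'} : Contracts t t' → LooseContracts t t'
  | dia (α : Pos) (x : ℕ) (β ε : Pos) (t u : Tree) :
      LooseContracts (.diaE α x (.diaI β ε t) u)
        (u.subst (Tree.diaE α x (.diaI β ε t) u).bound (Pos.replace (α.snoc x) ε) (single t))

/-- One subtree is replaced by a contractum of it in the sense of `LooseContracts`. -/
inductive LooseStep : Tree → Tree → Prop
  | contract {t t'} : LooseContracts t t' → LooseStep t t'
  | andI_left {t t' u} : LooseStep t t' → LooseStep (.andI t u) (.andI t' u)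
  | andI_right {t u u'} : LooseStep u u' → LooseStep (.andI t u) (.andI t u')
  | andE1 {t t'} : LooseStep t t' → LooseStep (.andE1 t) (.andE1 t')
  | andE2 {t t'} : LooseStep t t' → LooseStep (.andE2 t) (.andE2 t')
  | orI1 {B t t'} : LooseStep t t' → LooseStep (.orI1 B t) (.orI1 B t')
  | orI2 {A t t'} : LooseStep t t' → LooseStep (.orI2 A t) (.orI2 A t')
  | orE_major {t t' u v} : LooseStep t t' → LooseStep (.orE t u v) (.orE t' u v)
  | orE_left {t u u' v} : LooseStep u u' → LooseStep (.orE t u v) (.orE t u' v)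
  | orE_right {t u v v'} : LooseStep v v' → LooseStep (.orE t u v) (.orE t u v')
  | impI {A t t'} : LooseStep t t' → LooseStep (.impI A t) (.impI A t')
  | impE_major {t t' u} : LooseStep t t' → LooseStep (.impE t u) (.impE t' u)
  | impE_minor {t u u'} : LooseStep u u' → LooseStep (.impE t u) (.impE t u')
  | botI {β A α t t'} : LooseStep t t' → LooseStep (.botI β A α t) (.botI β A α t')
  | boxI {α x t t'} : LooseStep t t' → LooseStep (.boxI α x t) (.boxI α x t')
  | boxE {ε t t'} : LooseStep t t' → LooseStep (.boxE ε t) (.boxE ε t')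
  | diaI {α ε t t'} : LooseStep t t' → LooseStep (.diaI α ε t) (.diaI α ε t')
  | diaE_major {α x t t' u} : LooseStep t t' → LooseStep (.diaE α x t u) (.diaE α x t' u)
  | diaE_minor {α x t u u'} : LooseStep u u' → LooseStep (.diaE α x t u) (.diaE α x t u')

/-- Iterated loose reduction of trees. -/
abbrev Steps : Tree → Tree → Prop := Relation.ReflTransGen LooseStep

/-- The root of the tree is an assumption or an elimination rule other than `∨E` and `◇E`: with
such a tree above its major premiss, no elimination can be contracted. -/
def Tree.Neutral : Tree → Prop
  | .hyp _ _ => True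
  | .andE1 _ => True
  | .andE2 _ => True
  | .impE _ _ => True
  | .boxE _ _ => True
  | _ => False

/-- All major premisses of eliminations are neutral. For trees that come from deductions this is
the same as being irreducible; only the direction `Tree.NF.not_step` is needed. -/
def Tree.NF : Tree → Prop
  | .hyp _ _ => True
  | .andI t u => t.NF ∧ u.NF
  | .andE1 t => t.Neutral ∧ t.NF
  | .andE2 t => t.Neutral ∧ t.NF
  | .orI1 _ t => t.NF
  | .orI2 _ t => t.NF
  | .orE t u v => t.Neutral ∧ t.NF ∧ u.NF ∧ v.NF
  | .impI _ t => t.NF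
  | .impE t u => t.Neutral ∧ t.NF ∧ u.NF
  | .botI _ _ _ t => t.NF
  | .boxI _ _ t => t.NF
  | .boxE _ t => t.Neutral ∧ t.NF
  | .diaI _ _ t => t.NF
  | .diaE _ _ t u => t.Neutral ∧ t.NF ∧ u.NF

theorem Contracts.not_nf {t t' : Tree} (h : Contracts t t') : ¬ t.NF := by
  cases h with
  | commOr t u v R => cases R <;> simp [Elim.apply, Tree.NF, Tree.Neutral]
  | commDia α x t u R n hn => cases R <;> simp [Elim.apply, Tree.NF, Tree.Neutral]
  | _ => simp [Tree.NF, Tree.Neutral]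

theorem Step.not_nf {t t' : Tree} (h : Step t t') : ¬ t.NF := by
  induction h with
  | contract h => exact h.not_nf
  | _ => simp_all [Tree.NF]

theorem Tree.NF.not_step {t : Tree} (h : t.NF) (t' : Tree) : ¬ Step t t' := fun hs => hs.not_nf h

/-- The minor premisses of an elimination are normal. -/
def Elim.NF : Elim → Prop
  | .andE1 => True
  | .andE2 => True
  | .orE u v => u.NF ∧ v.NF
  | .impE u => u.NF
  | .boxE _ => True
  | .diaE _ _ u => u.NF

theorem Elim.NF.apply {R : Elim} (hR : R.NF) {t : Tree} (ht : t.NF) (hn : t.Neutral) :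
    (R.apply t).NF := by
  cases R <;> simp_all [Elim.NF, Elim.apply, Tree.NF]

theorem Elim.apply_steps (R : Elim) {t t' : Tree} (h : Steps t t') :
    Steps (R.apply t) (R.apply t') := by
  refine h.lift R.apply fun _ _ h => ?_
  cases R
  exacts [.andE1 h, .andE2 h, .orE_major h, .impE_major h, .boxE h, .diaE_major h]

theorem Tree.Neutral.rename {t : Tree} (h : t.Neutral) (r : ℕ → ℕ) : (t.rename r).Neutral := by
  cases t <;> simp_all [Tree.Neutral, Tree.rename]

theorem Tree.NF.rename {t : Tree} (h : t.NF) (r : ℕ → ℕ) : (t.rename r).NF := by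
  induction t generalizing r with
  | _ => simp_all [Tree.NF, Tree.rename, Tree.Neutral.rename]

theorem Elim.NF.raise {R : Elim} (h : R.NF) : R.raise.NF := by
  cases R <;> simp_all [Elim.NF, Elim.raise, Tree.NF.rename]

/-- The number of rule applications and leaves. -/
def Tree.size : Tree → ℕ
  | .hyp _ _ => 1
  | .andI t u => t.size + u.size + 1
  | .andE1 t => t.size + 1
  | .andE2 t => t.size + 1
  | .orI1 _ t => t.size + 1
  | .orI2 _ t => t.size + 1
  | .orE t u v => t.size + u.size + v.size + 1
  | .impI _ t => t.size + 1
  | .impE t u => t.size + u.size + 1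
  | .botI _ _ _ t => t.size + 1
  | .boxI _ _ t => t.size + 1
  | .boxE _ t => t.size + 1
  | .diaI _ _ t => t.size + 1
  | .diaE _ _ t u => t.size + u.size + 1

/-- The substitution has only assumption leaves as values. -/
def IsHypSub (σ : ℕ → PForm → Tree) : Prop := ∀ i p, ∃ j q, σ i p = .hyp j q

theorem isHypSub_hyp : IsHypSub .hyp := fun i p => ⟨i, p, rfl⟩

theorem IsHypSub.lift {σ : ℕ → PForm → Tree} (h : IsHypSub σ) : IsHypSub (liftSub σ)
  | 0, p => ⟨0, p, rfl⟩
  | i + 1, p => by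
    obtain ⟨j, q, e⟩ := h i p
    exact ⟨j + 1, q, by simp [liftSub, e, Tree.rename]⟩

theorem Tree.Neutral.subst_hyp {t : Tree} (h : t.Neutral) (n : ℕ) (f : Pos → Pos)
    {σ : ℕ → PForm → Tree} (hσ : IsHypSub σ) : (t.subst n f σ).Neutral := by
  cases t with
  | hyp i a =>
    obtain ⟨j, q, e⟩ := hσ i ⟨a.fml, f a.pos⟩
    simp [Tree.subst, e, Tree.Neutral]
  | _ => simp_all [Tree.Neutral, Tree.subst]

/-- Changing positions and names of assumptions creates no cut; a deletion of `⊥_i` may change the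
root of a tree, but never that of a neutral one. -/
theorem Tree.NF.subst_hyp {t : Tree} (h : t.NF) (n : ℕ) (f : Pos → Pos)
    {σ : ℕ → PForm → Tree} (hσ : IsHypSub σ) : (t.subst n f σ).NF := by
  induction t generalizing n f σ with
  | hyp i a =>
    obtain ⟨j, q, e⟩ := hσ i ⟨a.fml, f a.pos⟩
    simp [Tree.subst, e, Tree.NF]
  | botI β A α t ih =>
    simp only [Tree.subst]
    split_ifs
    exacts [ih h n f hσ, ih h n f hσ]
  | _ => simp_all [Tree.NF, Tree.subst, Tree.Neutral.subst_hyp, IsHypSub.lift]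

/-- The inequality can be strict, since applications of `⊥_i` may be deleted. -/
theorem Tree.size_subst_hyp_le (t : Tree) (n : ℕ) (f : Pos → Pos)
    {σ : ℕ → PForm → Tree} (hσ : IsHypSub σ) : (t.subst n f σ).size ≤ t.size := by
  induction t generalizing n f σ with
  | hyp i a =>
    obtain ⟨j, q, e⟩ := hσ i ⟨a.fml, f a.pos⟩
    simp [Tree.subst, e, Tree.size]
  | botI β A α t ih =>
    simp only [Tree.subst]
    have := ih n f hσ
    split_ifs <;> simp only [Tree.size] <;> omega
  | andI t u iht ihu =>
    have := iht n f hσ; have := ihu n f hσ; simp only [Tree.subst, Tree.size]; omega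
  | impE t u iht ihu =>
    have := iht n f hσ; have := ihu n f hσ; simp only [Tree.subst, Tree.size]; omega
  | orE t u v iht ihu ihv =>
    have := iht n f hσ; have := ihu n f hσ.lift; have := ihv n f hσ.lift
    simp only [Tree.subst, Tree.size]; omega
  | diaE α x t u iht ihu =>
    have := iht n f hσ
    have := ihu (n + 1) (Pos.update f (α.snoc x) ((f α).snoc n)) hσ.lift
    simp only [Tree.subst, Tree.size]; omega
  | _ => simp_all [Tree.subst, Tree.size, IsHypSub.lift]

/-! ### Typing without positions -/

/-- Extend an assignment of formulas to indices over a discharge of `A`. -/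
def push (A : Fml) (Γ : ℕ → Fml) : ℕ → Fml
  | 0 => A
  | i + 1 => Γ i

/-- `Typed Γ t A`: if positions, existence formulas and side conditions are ignored, `t` is a
deduction of `A`, the assumptions with index `i` being `Γ i`. -/
inductive Typed : (ℕ → Fml) → Tree → Fml → Prop
  | hyp {Γ i a} : Γ i = a.fml → Typed Γ (.hyp i a) a.fml
  | andI {Γ t u A B} : Typed Γ t A → Typed Γ u B → Typed Γ (.andI t u) (.and A B)
  | andE1 {Γ t A B} : Typed Γ t (.and A B) → Typed Γ (.andE1 t) A
  | andE2 {Γ t A B} : Typed Γ t (.and A B) → Typed Γ (.andE2 t) B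
  | orI1 {Γ t A B} : Typed Γ t A → Typed Γ (.orI1 B t) (.or A B)
  | orI2 {Γ t A B} : Typed Γ t B → Typed Γ (.orI2 A t) (.or A B)
  | orE {Γ t u v A B C} : Typed Γ t (.or A B) → Typed (push A Γ) u C → Typed (push B Γ) v C →
      Typed Γ (.orE t u v) C
  | impI {Γ t A B} : Typed (push A Γ) t B → Typed Γ (.impI A t) (.imp A B)
  | impE {Γ t u A B} : Typed Γ t (.imp A B) → Typed Γ u A → Typed Γ (.impE t u) B
  | botI {Γ t β A α} : Typed Γ t .bot → A.IsAtomic → Typed Γ (.botI β A α t) A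
  | boxI {Γ t A α x} : Typed Γ t A → Typed Γ (.boxI α x t) (.box A)
  | boxE {Γ t A ε} : Typed Γ t (.box A) → Typed Γ (.boxE ε t) A
  | diaI {Γ t A α ε} : Typed Γ t A → Typed Γ (.diaI α ε t) (.dia A)
  | diaE {Γ t u A α x C} : Typed Γ t (.dia A) → Typed (push A Γ) u C → Typed Γ (.diaE α x t u) C

/-- `R.Typed Γ A C`: the elimination `R` leads from a major premiss `A` to `C`. -/
inductive Elim.Typed (Γ : ℕ → Fml) : Elim → Fml → Fml → Prop
  | andE1 {A B} : Elim.Typed Γ .andE1 (.and A B) A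
  | andE2 {A B} : Elim.Typed Γ .andE2 (.and A B) B
  | orE {u v A B C} : PosND.Typed (push A Γ) u C → PosND.Typed (push B Γ) v C →
      Elim.Typed Γ (.orE u v) (.or A B) C
  | impE {u A B} : PosND.Typed Γ u A → Elim.Typed Γ (.impE u) (.imp A B) B
  | boxE {ε A} : Elim.Typed Γ (.boxE ε) (.box A) A
  | diaE {α x u A C} : PosND.Typed (push A Γ) u C → Elim.Typed Γ (.diaE α x u) (.dia A) C

theorem Elim.Typed.apply {Γ : ℕ → Fml} {R : Elim} {A C : Fml} {t : Tree} (hR : R.Typed Γ A C)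
    (ht : PosND.Typed Γ t A) : PosND.Typed Γ (R.apply t) C := by
  cases hR with
  | andE1 => exact .andE1 ht
  | andE2 => exact .andE2 ht
  | orE hu hv => exact .orE ht hu hv
  | impE hu => exact .impE ht hu
  | boxE => exact .boxE ht
  | diaE hu => exact .diaE ht hu

theorem push_liftRen {Γ Δ : ℕ → Fml} {r : ℕ → ℕ} (h : ∀ i, Δ (r i) = Γ i) (A : Fml) :
    ∀ i, push A Δ (liftRen r i) = push A Γ i
  | 0 => rfl
  | i + 1 => h i

theorem Typed.rename {Γ Δ : ℕ → Fml} {t : Tree} {A : Fml} (ht : Typed Γ t A) {r : ℕ → ℕ}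
    (h : ∀ i, Δ (r i) = Γ i) : Typed Δ (t.rename r) A := by
  induction ht generalizing Δ r with
  | hyp e => exact .hyp ((h _).trans e)
  | andI _ _ iht ihu => exact .andI (iht h) (ihu h)
  | andE1 _ ih => exact .andE1 (ih h)
  | andE2 _ ih => exact .andE2 (ih h)
  | orI1 _ ih => exact .orI1 (ih h)
  | orI2 _ ih => exact .orI2 (ih h)
  | orE _ _ _ iht ihu ihv =>
    exact .orE (iht h) (ihu (push_liftRen h _)) (ihv (push_liftRen h _))
  | impI _ ih => exact .impI (ih (push_liftRen h _))
  | impE _ _ iht ihu => exact .impE (iht h) (ihu h)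
  | botI _ ha ih => exact .botI (ih h) ha
  | boxI _ ih => exact .boxI (ih h)
  | boxE _ ih => exact .boxE (ih h)
  | diaI _ ih => exact .diaI (ih h)
  | diaE _ _ iht ihu => exact .diaE (iht h) (ihu (push_liftRen h _))

theorem Elim.Typed.raise {Γ : ℕ → Fml} {R : Elim} {A C : Fml} (hR : R.Typed Γ A C) (B : Fml) :
    R.raise.Typed (push B Γ) A C := by
  have h : ∀ i, push B Γ (Nat.succ i) = Γ i := fun _ => rfl
  cases hR with
  | andE1 => exact .andE1
  | andE2 => exact .andE2
  | orE hu hv => exact .orE (hu.rename (push_liftRen h _)) (hv.rename (push_liftRen h _))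
  | impE hu => exact .impE (hu.rename h)
  | boxE => exact .boxE
  | diaE hu => exact .diaE (hu.rename (push_liftRen h _))

/-- The substitution `σ` sends assumptions typed by `Γ` to trees that are typed by `Δ`. -/
def TypedSub (Γ Δ : ℕ → Fml) (σ : ℕ → PForm → Tree) : Prop :=
  ∀ i p, Γ i = p.fml → Typed Δ (σ i p) p.fml

theorem TypedSub.lift {Γ Δ : ℕ → Fml} {σ : ℕ → PForm → Tree} (h : TypedSub Γ Δ σ) (A : Fml) :
    TypedSub (push A Γ) (push A Δ) (liftSub σ)
  | 0, _, e => .hyp e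
  | i + 1, p, e => (h i p e).rename fun _ => rfl

theorem typedSub_hyp (Γ : ℕ → Fml) : TypedSub Γ Γ .hyp := fun _ _ e => .hyp e

theorem Typed.subst {Γ Δ : ℕ → Fml} {t : Tree} {A : Fml} (ht : Typed Γ t A) (n : ℕ)
    (f : Pos → Pos) {σ : ℕ → PForm → Tree} (h : TypedSub Γ Δ σ) : Typed Δ (t.subst n f σ) A := by
  induction ht generalizing Δ n f σ with
  | @hyp Γ i a e => exact h i ⟨a.fml, f a.pos⟩ e
  | andI _ _ iht ihu => exact .andI (iht n f h) (ihu n f h)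
  | andE1 _ ih => exact .andE1 (ih n f h)
  | andE2 _ ih => exact .andE2 (ih n f h)
  | orI1 _ ih => exact .orI1 (ih n f h)
  | orI2 _ ih => exact .orI2 (ih n f h)
  | orE _ _ _ iht ihu ihv => exact .orE (iht n f h) (ihu n f (h.lift _)) (ihv n f (h.lift _))
  | impI _ ih => exact .impI (ih n f (h.lift _))
  | impE _ _ iht ihu => exact .impE (iht n f h) (ihu n f h)
  | botI _ ha ih =>
    simp only [Tree.subst]
    split_ifs with hc
    · rw [hc.1]; exact ih n f h
    · exact .botI (ih n f h) ha
  | boxI _ ih => exact .boxI (ih _ _ h)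
  | boxE _ ih => exact .boxE (ih n f h)
  | diaI _ ih => exact .diaI (ih n f h)
  | diaE _ _ iht ihu => exact .diaE (iht n f h) (ihu _ _ (h.lift _))

/-! ### Normalization of typed trees -/

/-- The number of logical symbols. -/
def Fml.deg : Fml → ℕ
  | .prop _ => 0
  | .bot => 0
  | .and A B => A.deg + B.deg + 1
  | .or A B => A.deg + B.deg + 1
  | .imp A B => A.deg + B.deg + 1
  | .box A => A.deg + 1
  | .dia A => A.deg + 1

/-- `t` reduces to a normal tree of the same type. -/
def Normalizes (Γ : ℕ → Fml) (t : Tree) (A : Fml) : Prop :=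
  ∃ t', Steps t t' ∧ t'.NF ∧ Typed Γ t' A

theorem Normalizes.of_steps {Γ : ℕ → Fml} {t u : Tree} {A : Fml} (h : Steps t u)
    (hu : Normalizes Γ u A) : Normalizes Γ t A :=
  let ⟨t', h1, h2⟩ := hu
  ⟨t', h.trans h1, h2⟩

/-- Cuts of degree less than `d` normalize: an elimination applied to a normal tree. -/
def ElimNormalizes (d : ℕ) : Prop :=
  ∀ (s : Tree) (Γ : ℕ → Fml) (A C : Fml) (R : Elim), A.deg < d → Typed Γ s A → s.NF →
    R.Typed Γ A C → R.NF → Normalizes Γ (R.apply s) C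

/-- The substitution `σ` sends assumptions typed by `Γ` to normal trees typed by `Δ`, and all those
that are not neutral have formulas of degree less than `d`. -/
def NormalSub (d : ℕ) (Γ Δ : ℕ → Fml) (σ : ℕ → PForm → Tree) : Prop :=
  ∀ i p, Γ i = p.fml →
    Typed Δ (σ i p) p.fml ∧ (σ i p).NF ∧ ((σ i p).Neutral ∨ p.fml.deg < d)

theorem NormalSub.lift {d : ℕ} {Γ Δ : ℕ → Fml} {σ : ℕ → PForm → Tree} (h : NormalSub d Γ Δ σ)
    (A : Fml) : NormalSub d (push A Γ) (push A Δ) (liftSub σ)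
  | 0, _, e => ⟨.hyp e, trivial, .inl trivial⟩
  | i + 1, p, e =>
    let ⟨h1, h2, h3⟩ := h i p e
    ⟨h1.rename fun _ => rfl, h2.rename _, h3.imp_left fun h => h.rename _⟩

theorem normalSub_single {d : ℕ} {Γ : ℕ → Fml} {A : Fml} {t : Tree} (ht : Typed Γ t A)
    (hn : t.NF) (hd : A.deg < d) : NormalSub d (push A Γ) Γ (single t)
  | 0, p, e => by
    obtain rfl : A = p.fml := e
    exact ⟨ht, hn, .inr hd⟩
  | _ + 1, _, e => ⟨.hyp e, trivial, .inl trivial⟩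

/-- A normalizing major premiss may be put under an elimination if its normal form is neutral or
the cut has small degree. -/
theorem ElimNormalizes.apply {d : ℕ} (hE : ElimNormalizes d) {Γ : ℕ → Fml} {A C : Fml}
    {t s : Tree} {R : Elim} (hs : Steps t s) (ht : Typed Γ s A) (hn : s.NF)
    (hd : s.Neutral ∨ A.deg < d) (hR : R.Typed Γ A C) (hRn : R.NF) :
    Normalizes Γ (R.apply t) C := by
  refine .of_steps (R.apply_steps hs) ?_
  rcases hd with hd | hd
  · exact ⟨_, .refl, hRn.apply hn hd, hR.apply ht⟩
  · exact hE s Γ A C R hd ht hn hR hRn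

/-- As `ElimNormalizes.apply`, for eliminations whose conclusion is a part of the major premiss:
the result inherits the alternative "neutral or of small degree". -/
theorem ElimNormalizes.apply_neutral {d : ℕ} (hE : ElimNormalizes d) {Γ : ℕ → Fml} {A C : Fml}
    {t s : Tree} {R : Elim} (hs : Steps t s) (ht : Typed Γ s A) (hn : s.NF)
    (hd : s.Neutral ∨ A.deg < d) (hR : R.Typed Γ A C) (hRn : R.NF)
    (hN : ∀ s, (R.apply s).Neutral) (hdeg : C.deg < A.deg) :
    ∃ t', Steps (R.apply t) t' ∧ t'.NF ∧ Typed Γ t' C ∧ (t'.Neutral ∨ C.deg < d) := by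
  rcases hd with hd | hd
  · exact ⟨_, R.apply_steps hs, hRn.apply hn hd, hR.apply ht, .inl (hN s)⟩
  · obtain ⟨t', h1, h2, h3⟩ := hE.apply hs ht hn (.inr hd) hR hRn
    exact ⟨t', h1, h2, h3, .inr (hdeg.trans hd)⟩

theorem steps_two (F : Tree → Tree → Tree)
    (h1 : ∀ {t t' u}, LooseStep t t' → LooseStep (F t u) (F t' u))
    (h2 : ∀ {t u u'}, LooseStep u u' → LooseStep (F t u) (F t u')) {t t' u u' : Tree} (ht : Steps t t')
    (hu : Steps u u') : Steps (F t u) (F t' u') :=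
  (ht.lift (fun t => F t u) fun _ _ h => h1 h).trans (hu.lift (F t') fun _ _ h => h2 h)

/-- Hereditary substitution: a normal tree under a normal substitution normalizes, provided that
cuts of the degrees that the substitution creates normalize. A cut arises only where the head of a
neutral major premiss is replaced, and then its formula is a part of the formula of the head. -/
theorem ElimNormalizes.subst {d : ℕ} (hE : ElimNormalizes d) {t : Tree} {Γ Δ : ℕ → Fml} {A : Fml}
    (ht : Typed Γ t A) (hn : t.NF) (n : ℕ) (f : Pos → Pos) {σ : ℕ → PForm → Tree}
    (hσ : NormalSub d Γ Δ σ) :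
    ∃ t', Steps (t.subst n f σ) t' ∧ t'.NF ∧ Typed Δ t' A ∧
      (t.Neutral → t'.Neutral ∨ A.deg < d) := by
  induction ht generalizing Δ n f σ with
  | @hyp Γ i a e =>
    obtain ⟨h1, h2, h3⟩ := hσ i ⟨a.fml, f a.pos⟩ e
    exact ⟨_, .refl, h2, h1, fun _ => h3⟩
  | andI _ _ iht ihu =>
    obtain ⟨t', ht1, ht2, ht3, -⟩ := iht hn.1 n f hσ
    obtain ⟨u', hu1, hu2, hu3, -⟩ := ihu hn.2 n f hσ
    exact ⟨_, steps_two Tree.andI .andI_left .andI_right ht1 hu1, ⟨ht2, hu2⟩, .andI ht3 hu3,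
      False.elim⟩
  | andE1 _ ih =>
    obtain ⟨t', h1, h2, h3, h4⟩ := ih hn.2 n f hσ
    obtain ⟨s, hs⟩ := hE.apply_neutral h1 h3 h2 (h4 hn.1) .andE1 trivial (fun _ => trivial)
      (by simp only [Fml.deg]; omega)
    exact ⟨s, hs.1, hs.2.1, hs.2.2.1, fun _ => hs.2.2.2⟩
  | andE2 _ ih =>
    obtain ⟨t', h1, h2, h3, h4⟩ := ih hn.2 n f hσ
    obtain ⟨s, hs⟩ := hE.apply_neutral h1 h3 h2 (h4 hn.1) .andE2 trivial (fun _ => trivial)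
      (by simp only [Fml.deg]; omega)
    exact ⟨s, hs.1, hs.2.1, hs.2.2.1, fun _ => hs.2.2.2⟩
  | orI1 _ ih =>
    obtain ⟨t', h1, h2, h3, -⟩ := ih hn n f hσ
    exact ⟨_, h1.lift _ fun _ _ h => .orI1 h, h2, .orI1 h3, False.elim⟩
  | orI2 _ ih =>
    obtain ⟨t', h1, h2, h3, -⟩ := ih hn n f hσ
    exact ⟨_, h1.lift _ fun _ _ h => .orI2 h, h2, .orI2 h3, False.elim⟩
  | orE _ _ _ iht ihu ihv =>
    obtain ⟨t', ht1, ht2, ht3, ht4⟩ := iht hn.2.1 n f hσ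
    obtain ⟨u', hu1, hu2, hu3, -⟩ := ihu hn.2.2.1 n f (hσ.lift _)
    obtain ⟨v', hv1, hv2, hv3, -⟩ := ihv hn.2.2.2 n f (hσ.lift _)
    obtain ⟨s, hs1, hs2, hs3⟩ := hE.apply ht1 ht3 ht2 (ht4 hn.1) (.orE hu3 hv3) ⟨hu2, hv2⟩
    exact ⟨s, (steps_two (Tree.orE _) .orE_left .orE_right hu1 hv1).trans hs1, hs2, hs3, False.elim⟩
  | impI _ ih =>
    obtain ⟨t', h1, h2, h3, -⟩ := ih hn n f (hσ.lift _)
    exact ⟨_, h1.lift _ fun _ _ h => .impI h, h2, .impI h3, False.elim⟩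
  | impE _ _ iht ihu =>
    obtain ⟨t', h1, h2, h3, h4⟩ := iht hn.2.1 n f hσ
    obtain ⟨u', hu1, hu2, hu3, -⟩ := ihu hn.2.2 n f hσ
    obtain ⟨s, hs⟩ := hE.apply_neutral h1 h3 h2 (h4 hn.1) (.impE hu3) hu2 (fun _ => trivial)
      (by simp only [Fml.deg]; omega)
    exact ⟨s, (hu1.lift _ fun _ _ h => .impE_minor h).trans hs.1, hs.2.1, hs.2.2.1,
      fun _ => hs.2.2.2⟩
  | botI _ ha ih =>
    obtain ⟨t', h1, h2, h3, -⟩ := ih hn n f hσ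
    simp only [Tree.subst]
    split_ifs with hc
    · rw [hc.1]; exact ⟨t', h1, h2, h3, False.elim⟩
    · exact ⟨_, h1.lift _ fun _ _ h => .botI h, h2, .botI h3 ha, False.elim⟩
  | boxI _ ih =>
    obtain ⟨t', h1, h2, h3, -⟩ := ih hn _ _ hσ
    exact ⟨_, h1.lift _ fun _ _ h => .boxI h, h2, .boxI h3, False.elim⟩
  | @boxE Γ t A ε _ ih =>
    obtain ⟨t', h1, h2, h3, h4⟩ := ih hn.2 n f hσ
    obtain ⟨s, hs⟩ := hE.apply_neutral h1 h3 h2 (h4 hn.1) (.boxE (ε := f ε)) trivial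
      (fun _ => trivial) (by simp only [Fml.deg]; omega)
    exact ⟨s, hs.1, hs.2.1, hs.2.2.1, fun _ => hs.2.2.2⟩
  | diaI _ ih =>
    obtain ⟨t', h1, h2, h3, -⟩ := ih hn n f hσ
    exact ⟨_, h1.lift _ fun _ _ h => .diaI h, h2, .diaI h3, False.elim⟩
  | @diaE Γ t u A α x C _ _ iht ihu =>
    obtain ⟨t', ht1, ht2, ht3, ht4⟩ := iht hn.2.1 n f hσ
    obtain ⟨u', hu1, hu2, hu3, -⟩ :=
      ihu hn.2.2 (n + 1) (Pos.update f (α.snoc x) ((f α).snoc n)) (hσ.lift _)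
    obtain ⟨s, hs1, hs2, hs3⟩ :=
      hE.apply ht1 ht3 ht2 (ht4 hn.1) (.diaE (α := f α) (x := n) hu3) hu2
    exact ⟨s, (hu1.lift _ fun _ _ h => .diaE_minor h).trans hs1, hs2, hs3, False.elim⟩

theorem ElimNormalizes.single {d : ℕ} (hE : ElimNormalizes d) {t u : Tree} {Γ : ℕ → Fml}
    {A C : Fml} (hu : Typed (push A Γ) u C) (hun : u.NF) (ht : Typed Γ t A) (htn : t.NF)
    (hd : A.deg < d) (n : ℕ) (f : Pos → Pos) : Normalizes Γ (u.subst n f (single t)) C :=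
  let ⟨t', h1, h2, h3, _⟩ := hE.subst hu hun n f (normalSub_single ht htn hd)
  ⟨t', h1, h2, h3⟩

/-- Cuts of degree `d` normalize if those of smaller degree do. A proper contraction leads to a
hereditary substitution for a part of the cut formula; a commutative contraction moves the cut into
smaller trees. -/
theorem ElimNormalizes.succ {d : ℕ} (hE : ElimNormalizes d) : ElimNormalizes (d + 1) := by
  intro s
  induction hk : s.size using Nat.strong_induction_on generalizing s with
  | _ k IH =>
  subst hk
  intro Γ A C R hd hs hn hR hRn
  cases hs with
  | hyp e => exact ⟨_, .refl, hRn.apply hn trivial, hR.apply (.hyp e)⟩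
  | andE1 h => exact ⟨_, .refl, hRn.apply hn trivial, hR.apply (.andE1 h)⟩
  | andE2 h => exact ⟨_, .refl, hRn.apply hn trivial, hR.apply (.andE2 h)⟩
  | impE h h' => exact ⟨_, .refl, hRn.apply hn trivial, hR.apply (.impE h h')⟩
  | boxE h => exact ⟨_, .refl, hRn.apply hn trivial, hR.apply (.boxE h)⟩
  | botI h ha =>
    -- The conclusion of `⊥_i` is atomic, hence no elimination applies to it.
    cases ha <;> cases hR
  | andI ht hu =>
    cases hR with
    | andE1 => exact ⟨_, .single (.contract (.of (.and1 _ _))), hn.1, ht⟩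
    | andE2 => exact ⟨_, .single (.contract (.of (.and2 _ _))), hn.2, hu⟩
  | orI1 ht =>
    cases hR with
    | orE hu hv =>
      exact .of_steps (.single (.contract (.of (.or1 _ _ _ _))))
        (hE.single hu hRn.1 ht hn (by simp only [Fml.deg] at hd; omega) _ _)
  | orI2 ht =>
    cases hR with
    | orE hu hv =>
      exact .of_steps (.single (.contract (.of (.or2 _ _ _ _))))
        (hE.single hv hRn.2 ht hn (by simp only [Fml.deg] at hd; omega) _ _)
  | impI ht =>
    cases hR with
    | impE hu =>
      exact .of_steps (.single (.contract (.of (.imp _ _ _))))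
        (hE.single ht hn hu hRn (by simp only [Fml.deg] at hd; omega) _ _)
  | @boxI _ t _ _ _ ht =>
    cases hR with
    | boxE =>
      exact ⟨_, .single (.contract (.of (.box _ _ _ _))),
        Tree.NF.subst_hyp (t := t) hn _ _ isHypSub_hyp, ht.subst _ _ (typedSub_hyp Γ)⟩
  | diaI ht =>
    cases hR with
    | diaE hu =>
      exact .of_steps (.single (.contract (.dia _ _ _ _ _ _)))
        (hE.single hu hRn ht hn (by simp only [Fml.deg] at hd; omega) _ _)
  | @orE _ t u v _ _ _ ht hu hv =>
    obtain ⟨u', hu1, hu2, hu3⟩ := IH _ (by simp only [Tree.size]; omega) u rfl _ _ _ _ hd hu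
      hn.2.2.1 (hR.raise _) hRn.raise
    obtain ⟨v', hv1, hv2, hv3⟩ := IH _ (by simp only [Tree.size]; omega) v rfl _ _ _ _ hd hv
      hn.2.2.2 (hR.raise _) hRn.raise
    exact ⟨_, .head (.contract (.of (.commOr _ _ _ _)))
      (steps_two (Tree.orE _) .orE_left .orE_right hu1 hv1),
      ⟨hn.1, hn.2.1, hu2, hv2⟩, .orE ht hu3 hv3⟩
  | @diaE _ t u _ α x _ ht hu =>
    obtain ⟨u', hu1, hu2, hu3⟩ := IH _
      ((Tree.size_subst_hyp_le u _ _ isHypSub_hyp).trans_lt (by simp only [Tree.size]; omega))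
      _ rfl _ _ _ _ hd (hu.subst ((R.apply (.diaE α x t u)).bound + 1)
        (Pos.replace (α.snoc x) (α.snoc (R.apply (.diaE α x t u)).bound)) (typedSub_hyp _))
      (hn.2.2.subst_hyp _ _ isHypSub_hyp) (hR.raise _) hRn.raise
    exact ⟨_, .head (.contract (.of (.commDia α x t u R _ rfl)))
      (hu1.lift _ fun _ _ h => .diaE_minor h), ⟨hn.1, hn.2.1, hu2⟩, .diaE ht hu3⟩

theorem elimNormalizes (d : ℕ) : ElimNormalizes d := by
  induction d with
  | zero => exact fun _ _ _ _ _ h => absurd h (Nat.not_lt_zero _)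
  | succ d ih => exact ih.succ

/-- Cuts of every degree normalize. -/
theorem Normalizes.elim {Γ : ℕ → Fml} {t : Tree} {A C : Fml} {R : Elim} (ht : Normalizes Γ t A)
    (hR : R.Typed Γ A C) (hRn : R.NF) : Normalizes Γ (R.apply t) C :=
  let ⟨_, h1, h2, h3⟩ := ht
  (elimNormalizes (A.deg + 1)).apply h1 h3 h2 (.inr A.deg.lt_succ_self) hR hRn

/-- Normalization of typed trees, by normalizing the premisses and then the last elimination. -/
theorem Typed.normalizes {Γ : ℕ → Fml} {t : Tree} {A : Fml} (ht : Typed Γ t A) :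
    Normalizes Γ t A := by
  induction ht with
  | hyp e => exact ⟨_, .refl, trivial, .hyp e⟩
  | andI _ _ iht ihu =>
    obtain ⟨t', ht1, ht2, ht3⟩ := iht
    obtain ⟨u', hu1, hu2, hu3⟩ := ihu
    exact ⟨_, steps_two Tree.andI .andI_left .andI_right ht1 hu1, ⟨ht2, hu2⟩, .andI ht3 hu3⟩
  | andE1 _ ih => exact ih.elim .andE1 trivial
  | andE2 _ ih => exact ih.elim .andE2 trivial
  | orI1 _ ih =>
    obtain ⟨t', h1, h2, h3⟩ := ih
    exact ⟨_, h1.lift _ fun _ _ h => .orI1 h, h2, .orI1 h3⟩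
  | orI2 _ ih =>
    obtain ⟨t', h1, h2, h3⟩ := ih
    exact ⟨_, h1.lift _ fun _ _ h => .orI2 h, h2, .orI2 h3⟩
  | orE _ _ _ iht ihu ihv =>
    obtain ⟨u', hu1, hu2, hu3⟩ := ihu
    obtain ⟨v', hv1, hv2, hv3⟩ := ihv
    exact .of_steps (steps_two (Tree.orE _) .orE_left .orE_right hu1 hv1)
      (iht.elim (.orE hu3 hv3) ⟨hu2, hv2⟩)
  | impI _ ih =>
    obtain ⟨t', h1, h2, h3⟩ := ih
    exact ⟨_, h1.lift _ fun _ _ h => .impI h, h2, .impI h3⟩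
  | impE _ _ iht ihu =>
    obtain ⟨u', hu1, hu2, hu3⟩ := ihu
    exact .of_steps (hu1.lift _ fun _ _ h => .impE_minor h) (iht.elim (.impE hu3) hu2)
  | botI _ ha ih =>
    obtain ⟨t', h1, h2, h3⟩ := ih
    exact ⟨_, h1.lift _ fun _ _ h => .botI h, h2, .botI h3 ha⟩
  | boxI _ ih =>
    obtain ⟨t', h1, h2, h3⟩ := ih
    exact ⟨_, h1.lift _ fun _ _ h => .boxI h, h2, .boxI h3⟩
  | @boxE _ _ _ ε _ ih => exact ih.elim (.boxE (ε := ε)) trivial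
  | diaI _ ih =>
    obtain ⟨t', h1, h2, h3⟩ := ih
    exact ⟨_, h1.lift _ fun _ _ h => .diaI h, h2, .diaI h3⟩
  | @diaE _ _ _ _ α x _ _ _ iht ihu =>
    obtain ⟨u', hu1, hu2, hu3⟩ := ihu
    exact .of_steps (hu1.lift _ fun _ _ h => .diaE_minor h)
      (iht.elim (.diaE (α := α) (x := x) hu3) hu2)

/-- The formula of the assumption with index `i` (an arbitrary one if there is none). -/
def ctxFml (Γ : List PForm) (i : ℕ) : Fml := (Γ[i]?.map PForm.fml).getD .bot

theorem ctxFml_cons (a : PForm) (Γ : List PForm) : ctxFml (a :: Γ) = push a.fml (ctxFml Γ) := by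
  funext i
  cases i <;> simp [ctxFml, push]

theorem IsDeduction.typed {S : System} {Γ : List PForm} {Ξ : List Pos} {t : Tree} {a : PForm}
    (h : IsDeduction S Γ Ξ t a) : Typed (ctxFml Γ) t a.fml := by
  induction h with
  | hyp h => exact .hyp (by simp [ctxFml, h])
  | andI _ _ iht ihu => exact .andI iht ihu
  | andE1 _ ih => exact .andE1 ih
  | andE2 _ ih => exact .andE2 ih
  | orI1 _ ih => exact .orI1 ih
  | orI2 _ ih => exact .orI2 ih
  | orE _ _ _ iht ihu ihv =>
    rw [ctxFml_cons] at ihu ihv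
    exact .orE iht ihu ihv
  | impI _ ih =>
    rw [ctxFml_cons] at ih
    exact .impI ih
  | impE _ _ iht ihu => exact .impE iht ihu
  | botI _ ha _ ih => exact .botI ih ha
  | boxI _ _ _ ih => exact .boxI ih
  | boxE _ _ _ _ ih => exact .boxE ih
  | diaI _ _ _ _ ih => exact .diaI ih
  | diaE _ _ _ _ _ iht ihu =>
    rw [ctxFml_cons] at ihu
    exact .diaE iht ihu

/-! ### Bounds on tokens -/

theorem Pos.lt_bound {α : Pos} {x : ℕ} (h : x ∈ α) : x < α.bound := by
  induction α with
  | nil => simp at h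
  | cons y α ih =>
    rcases List.mem_cons.1 h with rfl | h
    · exact lt_max_of_lt_left (Nat.lt_succ_self _)
    · exact lt_max_of_lt_right (ih h)

theorem Pos.bound_le_iff {α : Pos} {n : ℕ} : α.bound ≤ n ↔ ∀ x ∈ α, x < n := by
  refine ⟨fun h x hx => (Pos.lt_bound hx).trans_le h, fun h => ?_⟩
  induction α with
  | nil => exact Nat.zero_le _
  | cons y α ih =>
    exact max_le (h y List.mem_cons_self) (ih fun x hx => h x (List.mem_cons_of_mem _ hx))

theorem Pos.not_snoc_prefix {β : Pos} {n : ℕ} (h : β.bound ≤ n) (α : Pos) :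
    ¬ α.snoc n <+: β := fun hp =>
  absurd (Pos.bound_le_iff.1 h n (hp.subset (by simp [Pos.snoc]))) (lt_irrefl n)

theorem Pos.bound_le_snoc (α : Pos) (x : ℕ) : α.bound ≤ (α.snoc x).bound :=
  Pos.bound_le_iff.2 fun _ hy => Pos.lt_bound (List.mem_append_left _ hy)

theorem Pos.bound_snoc_le {α : Pos} {x n : ℕ} (h : α.bound ≤ n) (hx : x < n) :
    (α.snoc x).bound ≤ n := by
  refine Pos.bound_le_iff.2 fun y hy => ?_
  rcases List.mem_append.1 hy with hy | hy
  · exact Pos.bound_le_iff.1 h y hy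
  · rwa [List.mem_singleton.1 hy]

theorem Pos.update_of_not_prefix {u s : Pos} (h : ¬ u <+: s) (f : Pos → Pos) (v : Pos) :
    Pos.update f u v s = f s := if_neg h

theorem Pos.update_self (f : Pos → Pos) (u v : Pos) : Pos.update f u v u = v := by
  simp [Pos.update]

theorem mem_discharge {l : List (ℕ × PForm)} {i : ℕ} {a : PForm} :
    (i, a) ∈ discharge l ↔ (i + 1, a) ∈ l := by
  simp only [discharge, List.mem_map, List.mem_filter, Prod.exists, Prod.mk.injEq]
  constructor
  · rintro ⟨j, b, ⟨h, hj⟩, rfl, rfl⟩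
    cases j with
    | zero => simp at hj
    | succ j => exact h
  · exact fun h => ⟨i + 1, a, ⟨h, by simp⟩, rfl, rfl⟩

theorem discharge_subset {l l' : List (ℕ × PForm)} (h : l ⊆ l') : discharge l ⊆ discharge l' :=
  fun _ hp => mem_discharge.2 (h (mem_discharge.1 hp))

theorem Tree.bound_of_mem_opens {t : Tree} {i : ℕ} {a : PForm} (h : (i, a) ∈ t.opens) :
    a.pos.bound ≤ t.bound := by
  induction t generalizing i with
  | _ =>
    simp_all only [Tree.opens, Tree.bound, List.mem_append, mem_discharge, List.mem_singleton,
      Prod.mk.injEq, le_max_iff]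
    grind

theorem Tree.bound_of_mem_exts {t : Tree} {ε : Pos} (h : ε ∈ t.exts) : ε.bound ≤ t.bound := by
  induction t with
  | _ =>
    simp_all only [Tree.exts, Tree.bound, List.mem_append, List.mem_filter, List.mem_cons,
      le_max_iff, List.not_mem_nil] <;>
    grind

theorem IsDeduction.bound_pos {S : System} {Γ : List PForm} {Ξ : List Pos} {t : Tree} {a : PForm}
    (h : IsDeduction S Γ Ξ t a) : a.pos.bound ≤ t.bound := by
  induction h with
  | boxI => exact le_max_of_le_left (Pos.bound_le_snoc _ _)
  | _ => simp_all [Tree.bound]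

/-! ### Weakening -/

theorem exists_of_mem_opens_rename {t : Tree} {r : ℕ → ℕ} {j : ℕ} {a : PForm}
    (h : (j, a) ∈ (t.rename r).opens) : ∃ i, (i, a) ∈ t.opens ∧ j = r i := by
  induction t generalizing r j with
  | hyp i b => simp_all [Tree.rename, Tree.opens]
  | orE t u v iht ihu ihv =>
    simp only [Tree.rename, Tree.opens, List.mem_append, mem_discharge] at h ⊢
    rcases h with (h | h) | h
    · obtain ⟨i, h, e⟩ := iht h; exact ⟨i, .inl (.inl h), e⟩
    · obtain ⟨_ | i, h, e⟩ := ihu h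
      · simp [liftRen] at e
      · exact ⟨i, .inl (.inr h), by simpa [liftRen] using e⟩
    · obtain ⟨_ | i, h, e⟩ := ihv h
      · simp [liftRen] at e
      · exact ⟨i, .inr h, by simpa [liftRen] using e⟩
  | diaE α x t u iht ihu =>
    simp only [Tree.rename, Tree.opens, List.mem_append, mem_discharge] at h ⊢
    rcases h with h | h
    · obtain ⟨i, h, e⟩ := iht h; exact ⟨i, .inl h, e⟩
    · obtain ⟨_ | i, h, e⟩ := ihu h
      · simp [liftRen] at e
      · exact ⟨i, .inr h, by simpa [liftRen] using e⟩
  | impI A t ih =>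
    simp only [Tree.rename, Tree.opens, mem_discharge] at h ⊢
    obtain ⟨_ | i, h, e⟩ := ih h
    · simp [liftRen] at e
    · exact ⟨i, h, by simpa [liftRen] using e⟩
  | _ =>
    simp only [Tree.rename, Tree.opens, List.mem_append] at h ⊢
    grind

theorem Tree.exts_rename (t : Tree) (r : ℕ → ℕ) : (t.rename r).exts = t.exts := by
  induction t generalizing r with
  | _ => simp_all [Tree.rename, Tree.exts]

theorem NotInit.mono {π : Pos} {l l' : List (ℕ × PForm)} (h : NotInit π l)
    (hl : ∀ i a, (i, a) ∈ l' → ∃ j, (j, a) ∈ l) : NotInit π l' := by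
  rintro ⟨i, a⟩ hp
  obtain ⟨j, hj⟩ := hl i a hp
  exact h (j, a) hj

theorem getElem?_liftRen {Γ' : List PForm} {l : List (ℕ × PForm)} {r : ℕ → ℕ} {c : PForm}
    (h : ∀ i b, (i, b) ∈ discharge l → Γ'[r i]? = some b) (h0 : ∀ b, (0, b) ∈ l → b = c) :
    ∀ i b, (i, b) ∈ l → (c :: Γ')[liftRen r i]? = some b
  | 0, b, hb => by simp [liftRen, h0 b hb]
  | i + 1, b, hb => by simpa [liftRen] using h i b (mem_discharge.2 hb)

section
variable {S : System} {Γ Γ' : List PForm} {Ξ Ξ' : List Pos} {t : Tree} {a : PForm}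

theorem IsDeduction.getElem?_of_mem_opens (h : IsDeduction S Γ Ξ t a) {i : ℕ} {b : PForm}
    (hb : (i, b) ∈ t.opens) : Γ[i]? = some b := by
  induction h generalizing i with
  | _ =>
    simp only [Tree.opens, List.mem_append, mem_discharge, List.mem_singleton,
      Prod.mk.injEq] at hb
    grind

theorem IsDeduction.eq_of_mem_opens {c : PForm} (h : IsDeduction S (c :: Γ) Ξ t a) {b : PForm}
    (hb : (0, b) ∈ t.opens) : b = c := by
  simpa using (h.getElem?_of_mem_opens hb).symm

theorem IsDeduction.mem_of_mem_exts (h : IsDeduction S Γ Ξ t a) (hS : S.IsPartial) {ε : Pos}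
    (hε : ε ∈ t.exts) : ε ∈ Ξ := by
  induction h with
  | _ =>
    simp only [Tree.exts, List.mem_append, List.mem_filter, List.mem_cons, decide_eq_true_eq,
      List.not_mem_nil] at hε <;>
    grind

/-- Renaming of indices and change of contexts. Only the entries that belong to open leaves have to
be present in the new contexts: the discharged formula of a premiss need not be looked at. -/
theorem IsDeduction.rename (h : IsDeduction S Γ Ξ t a) {r : ℕ → ℕ}
    (hΓ : ∀ i b, (i, b) ∈ t.opens → Γ'[r i]? = some b)
    (hΞ : S.IsPartial → ∀ ε ∈ t.exts, ε ∈ Ξ') : IsDeduction S Γ' Ξ' (t.rename r) a := by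
  induction h generalizing Γ' Ξ' r with
  | hyp _ => exact .hyp (hΓ _ _ (by simp [Tree.opens]))
  | andI _ _ iht ihu =>
    simp only [Tree.opens, Tree.exts, List.mem_append] at hΓ hΞ
    exact .andI (iht (fun i b h => hΓ i b (.inl h)) fun hS ε h => hΞ hS ε (.inl h))
      (ihu (fun i b h => hΓ i b (.inr h)) fun hS ε h => hΞ hS ε (.inr h))
  | andE1 _ ih => exact .andE1 (ih hΓ hΞ)
  | andE2 _ ih => exact .andE2 (ih hΓ hΞ)
  | orI1 _ ih => exact .orI1 (ih hΓ hΞ)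
  | orI2 _ ih => exact .orI2 (ih hΓ hΞ)
  | orE _ hu hv iht ihu ihv =>
    simp only [Tree.opens, Tree.exts, List.mem_append] at hΓ hΞ
    exact .orE (iht (fun i b h => hΓ i b (.inl (.inl h))) fun hS ε h => hΞ hS ε (.inl (.inl h)))
      (ihu (getElem?_liftRen (fun i b h => hΓ i b (.inl (.inr h))) fun _ => hu.eq_of_mem_opens)
        fun hS ε h => hΞ hS ε (.inl (.inr h)))
      (ihv (getElem?_liftRen (fun i b h => hΓ i b (.inr h)) fun _ => hv.eq_of_mem_opens)
        fun hS ε h => hΞ hS ε (.inr h))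
  | impI ht ih =>
    exact .impI (ih (getElem?_liftRen hΓ fun _ => ht.eq_of_mem_opens) hΞ)
  | impE _ _ iht ihu =>
    simp only [Tree.opens, Tree.exts, List.mem_append] at hΓ hΞ
    exact .impE (iht (fun i b h => hΓ i b (.inl h)) fun hS ε h => hΞ hS ε (.inl h))
      (ihu (fun i b h => hΓ i b (.inr h)) fun hS ε h => hΞ hS ε (.inr h))
  | botI _ ha hne ih => exact .botI (ih hΓ hΞ) ha hne
  | @boxI _ _ _ _ α x ht hi he ih =>
    simp only [Tree.exts, List.mem_filter, decide_eq_true_eq] at hΞ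
    refine .boxI (ih hΓ fun hS ε h => ?_) (hi.mono fun i b h => ?_)
      (by rwa [Tree.exts_rename])
    · by_cases e : ε = α.snoc x
      · exact e ▸ List.mem_cons_self
      · exact List.mem_cons_of_mem _ (hΞ hS ε ⟨h, e⟩)
    · obtain ⟨j, hj, -⟩ := exists_of_mem_opens_rename h
      exact ⟨j, hj⟩
  | boxE _ he hc _ ih =>
    simp only [Tree.exts, List.mem_cons] at hΞ
    exact .boxE (ih hΓ fun hS ε h => hΞ hS ε (.inr h)) he hc fun hS => hΞ hS _ (.inl rfl)
  | diaI _ he hc _ ih =>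
    simp only [Tree.exts, List.mem_cons] at hΞ
    exact .diaI (ih hΓ fun hS ε h => hΞ hS ε (.inr h)) he hc fun hS => hΞ hS _ (.inl rfl)
  | @diaE _ _ _ _ _ α x _ _ _ hu hn hi he iht ihu =>
    simp only [Tree.opens, Tree.exts, List.mem_append, List.mem_filter,
      decide_eq_true_eq] at hΓ hΞ
    refine .diaE (iht (fun i b h => hΓ i b (.inl h)) fun hS ε h => hΞ hS ε (.inl h))
      (ihu (getElem?_liftRen (fun i b h => hΓ i b (.inr h)) fun _ => hu.eq_of_mem_opens)
        fun hS ε h => ?_) hn (hi.mono fun i b h => ?_) (by rwa [Tree.exts_rename])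
    · by_cases e : ε = α.snoc x
      · exact e ▸ List.mem_cons_self
      · exact List.mem_cons_of_mem _ (hΞ hS ε (.inr ⟨h, e⟩))
    · obtain ⟨_ | j, hj, e⟩ := exists_of_mem_opens_rename (mem_discharge.1 h)
      · simp [liftRen] at e
      · exact ⟨j, mem_discharge.2 hj⟩

theorem liftRen_id : liftRen id = id := by
  funext i
  cases i <;> rfl

theorem Tree.rename_id (t : Tree) : t.rename id = t := by
  induction t with
  | _ => simp_all [Tree.rename, liftRen_id]

theorem IsDeduction.mono_ext (h : IsDeduction S Γ Ξ t a) (hΞ : S.IsPartial → Ξ ⊆ Ξ') :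
    IsDeduction S Γ Ξ' t a := by
  have := h.rename (r := id) (Γ' := Γ) (Ξ' := Ξ') (fun _ _ hb => h.getElem?_of_mem_opens hb)
    fun hS ε hε => hΞ hS (h.mem_of_mem_exts hS hε)
  rwa [Tree.rename_id] at this

theorem IsDeduction.succ (h : IsDeduction S Γ Ξ t a) (c : PForm) :
    IsDeduction S (c :: Γ) Ξ (t.rename Nat.succ) a :=
  h.rename (fun _ _ hb => by simpa using h.getElem?_of_mem_opens hb)
    fun hS _ hε => h.mem_of_mem_exts hS hε

/-- Weakening of a premiss in which a formula `b` is discharged. -/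
theorem IsDeduction.lift_succ {b : PForm} (h : IsDeduction S (b :: Γ) Ξ t a) (c : PForm)
    (hΞ : S.IsPartial → Ξ ⊆ Ξ') :
    IsDeduction S (b :: c :: Γ) Ξ' (t.rename (liftRen Nat.succ)) a := by
  refine h.rename (fun i d hd => ?_) fun hS _ hε => hΞ hS (h.mem_of_mem_exts hS hε)
  have := h.getElem?_of_mem_opens hd
  cases i <;> simpa [liftRen] using this

end

/-! ### Substitution in deductions -/

/-- The position map `f` preserves the relation between `α` and `αβ` that the rules `□E` and `◇I` of
the system `S` require. -/
def Respects (S : System) (f : Pos → Pos) : Prop :=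
  ∀ α β, S.Constraint β → ∃ β', S.Constraint β' ∧ f (α ++ β) = f α ++ β'

theorem respects_id (S : System) : Respects S id := fun _ β h => ⟨β, h, rfl⟩

/-- Sending `αx` to `f(α)δ` keeps a map compatible with the modal rules. When a proper position is
renamed, `δ` has length one; in the proper contractions of the modalities, `δ` satisfies the
constraint of the system (in the system `T` it is empty). -/
theorem Respects.update {S : System} {f : Pos → Pos} (hf : Respects S f) {α δ : Pos} (x : ℕ)
    (hδ : δ.length = 1 ∨ S.Constraint δ) : Respects S (Pos.update f (α.snoc x) (f α ++ δ)) := by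
  intro s β hβ
  by_cases h1 : α.snoc x <+: s
  · refine ⟨β, hβ, ?_⟩
    rw [Pos.update, Pos.update, if_pos h1, if_pos (h1.trans (List.prefix_append s β)),
      List.drop_append_of_le_length h1.length_le]
    simp only [List.append_assoc]
  · rw [Pos.update_of_not_prefix h1]
    by_cases h2 : α.snoc x <+: s ++ β
    · -- Here `αx` ends inside `β`, so that `s` is a prefix `α = s η` and `β = η x r`.
      obtain ⟨r, hr⟩ := h2
      have hlen : s.length ≤ α.length := by
        by_contra hlt
        refine h1 (List.prefix_of_prefix_length_le (⟨r, hr⟩ : α.snoc x <+: s ++ β)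
          (List.prefix_append s β) ?_)
        simp [Pos.snoc]; omega
      obtain ⟨η, rfl⟩ : s <+: α := List.prefix_of_prefix_length_le (List.prefix_append s β)
        ((List.prefix_append α ([x] ++ r)).trans (by simp [← hr, Pos.snoc])) hlen
      obtain rfl : η ++ x :: r = β := by simpa [Pos.snoc] using hr
      have hup : Pos.update f (Pos.snoc (s ++ η) x) (f (s ++ η) ++ δ) (s ++ (η ++ x :: r)) =
          f (s ++ η) ++ δ ++ r := by
        have : s ++ (η ++ x :: r) = Pos.snoc (s ++ η) x ++ r := by simp [Pos.snoc]
        rw [this, Pos.update, if_pos (List.prefix_append _ _), List.drop_left]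
      rw [hup]
      rcases List.eq_nil_or_concat η with rfl | ⟨η', y, rfl⟩
      · refine ⟨δ ++ r, ?_, by simp⟩
        cases S <;> simp_all [System.Constraint] <;> grind
      · have key : S.Constraint (η' ++ [y]) := by
          cases S <;> simp_all [System.Constraint] <;> omega
        obtain ⟨η'', h, e⟩ := hf s _ (by simpa using key)
        refine ⟨η'' ++ δ ++ r, ?_, by simp_all⟩
        cases S <;> simp_all [System.Constraint]
    · rw [Pos.update_of_not_prefix h2]
      exact hf s β hβ

/-- Positions with tokens below `m` go to positions with tokens below `n`. -/
def BoundedMap (m n : ℕ) (f : Pos → Pos) : Prop := ∀ s : Pos, s.bound ≤ m → (f s).bound ≤ n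

theorem boundedMap_id (n : ℕ) : BoundedMap n n id := fun _ h => h

theorem BoundedMap.update {m n k : ℕ} {f : Pos → Pos} (h : BoundedMap m n f) {u v : Pos}
    (hv : v.bound ≤ k) (hm : m ≤ k) (hn : n ≤ k) : BoundedMap m k (Pos.update f u v) := by
  intro s hs
  unfold Pos.update
  split_ifs
  · refine Pos.bound_le_iff.2 fun x hx => ?_
    rcases List.mem_append.1 hx with hx | hx
    · exact Pos.bound_le_iff.1 hv x hx
    · exact (Pos.bound_le_iff.1 hs x (List.mem_of_mem_drop hx)).trans_le hm
  · exact (h s hs).trans hn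

/-- The position-formula `A^{f α}`. -/
def PForm.map (f : Pos → Pos) (a : PForm) : PForm := ⟨a.fml, f a.pos⟩

theorem exists_of_mem_opens_liftSub {σ : ℕ → PForm → Tree} {i j : ℕ} {a b : PForm}
    (h : (j + 1, b) ∈ (liftSub σ i a).opens) : ∃ k, i = k + 1 ∧ (j, b) ∈ (σ k a).opens := by
  cases i with
  | zero => simp [liftSub, Tree.opens] at h
  | succ k =>
    obtain ⟨i, hi, e⟩ := exists_of_mem_opens_rename h
    exact ⟨k, rfl, Nat.succ.inj e ▸ hi⟩

theorem exists_of_mem_exts_liftSub {σ : ℕ → PForm → Tree} {i : ℕ} {a : PForm} {ε : Pos}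
    (h : ε ∈ (liftSub σ i a).exts) : ∃ k, i = k + 1 ∧ ε ∈ (σ k a).exts := by
  cases i with
  | zero => simp [liftSub, Tree.exts] at h
  | succ k => exact ⟨k, rfl, by simpa [liftSub, Tree.exts_rename] using h⟩

section
variable {S : System} {Γ Γ' : List PForm} {Ξ Ξ' : List Pos} {t : Tree} {a : PForm}

/-- The open assumptions after a substitution stem from the images of the open assumptions before.
That the assumption leaves are moved by `f`, and not by the maps that rename the proper positions
below them, is due to the side conditions. -/
theorem IsDeduction.exists_of_mem_opens_subst (h : IsDeduction S Γ Ξ t a) {n : ℕ}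
    {f : Pos → Pos} {σ : ℕ → PForm → Tree} {j : ℕ} {b : PForm}
    (hb : (j, b) ∈ (t.subst n f σ).opens) :
    ∃ i c, (i, c) ∈ t.opens ∧ (j, b) ∈ (σ i (c.map f)).opens := by
  induction h generalizing n f σ j with
  | @hyp _ _ i c _ => exact ⟨i, c, by simp [Tree.opens], hb⟩
  | andI _ _ iht ihu | impE _ _ iht ihu =>
    simp only [Tree.subst, Tree.opens, List.mem_append] at hb ⊢
    rcases hb with hb | hb
    · obtain ⟨i, c, h1, h2⟩ := iht hb
      exact ⟨i, c, .inl h1, h2⟩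
    · obtain ⟨i, c, h1, h2⟩ := ihu hb
      exact ⟨i, c, .inr h1, h2⟩
  | andE1 _ ih | andE2 _ ih | orI1 _ ih | orI2 _ ih => exact ih hb
  | boxE _ _ _ _ ih | diaI _ _ _ _ ih => exact ih hb
  | orE _ _ _ iht ihu ihv =>
    simp only [Tree.subst, Tree.opens, List.mem_append, mem_discharge] at hb ⊢
    rcases hb with (hb | hb) | hb
    · obtain ⟨i, c, h1, h2⟩ := iht hb
      exact ⟨i, c, .inl (.inl h1), h2⟩
    · obtain ⟨i, c, h1, h2⟩ := ihu hb
      obtain ⟨k, rfl, h3⟩ := exists_of_mem_opens_liftSub h2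
      exact ⟨k, c, .inl (.inr h1), h3⟩
    · obtain ⟨i, c, h1, h2⟩ := ihv hb
      obtain ⟨k, rfl, h3⟩ := exists_of_mem_opens_liftSub h2
      exact ⟨k, c, .inr h1, h3⟩
  | impI _ ih =>
    simp only [Tree.subst, Tree.opens, mem_discharge] at hb ⊢
    obtain ⟨i, c, h1, h2⟩ := ih hb
    obtain ⟨k, rfl, h3⟩ := exists_of_mem_opens_liftSub h2
    exact ⟨k, c, h1, h3⟩
  | botI _ _ _ ih =>
    simp only [Tree.subst] at hb
    split_ifs at hb
    exacts [ih hb, ih hb]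
  | boxI _ hi _ ih =>
    obtain ⟨i, c, h1, h2⟩ := ih hb
    rw [PForm.map, Pos.update_of_not_prefix (hi _ h1)] at h2
    exact ⟨i, c, h1, h2⟩
  | diaE _ _ _ hi _ iht ihu =>
    simp only [Tree.subst, Tree.opens, List.mem_append, mem_discharge] at hb ⊢
    rcases hb with hb | hb
    · obtain ⟨i, c, h1, h2⟩ := iht hb
      exact ⟨i, c, .inl h1, h2⟩
    · obtain ⟨i, c, h1, h2⟩ := ihu hb
      obtain ⟨k, rfl, h3⟩ := exists_of_mem_opens_liftSub h2
      rw [PForm.map, Pos.update_of_not_prefix (hi _ (mem_discharge.2 h1))] at h3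
      exact ⟨k, c, .inr h1, h3⟩

/-- The open existence assumptions after a substitution are the images of those before, and those of
the trees that are substituted. -/
theorem IsDeduction.exists_of_mem_exts_subst (h : IsDeduction S Γ Ξ t a) (hS : S.IsPartial)
    {n : ℕ} {f : Pos → Pos} {σ : ℕ → PForm → Tree} {ε : Pos}
    (hε : ε ∈ (t.subst n f σ).exts) :
    (∃ ζ ∈ t.exts, ε = f ζ) ∨ ∃ i c, (i, c) ∈ t.opens ∧ ε ∈ (σ i (c.map f)).exts := by
  induction h generalizing n f σ with
  | @hyp _ _ i c _ => exact .inr ⟨i, c, by simp [Tree.opens], hε⟩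
  | andI _ _ iht ihu | impE _ _ iht ihu =>
    simp only [Tree.subst, Tree.opens, Tree.exts, List.mem_append] at hε ⊢
    rcases hε with hε | hε
    · have := iht hε; grind
    · have := ihu hε; grind
  | andE1 _ ih | andE2 _ ih | orI1 _ ih | orI2 _ ih => exact ih hε
  | boxE _ _ _ _ ih | diaI _ _ _ _ ih =>
    simp only [Tree.subst, Tree.opens, Tree.exts, List.mem_cons] at hε ⊢
    rcases hε with hε | hε
    · exact .inl ⟨_, .inl rfl, hε⟩
    · have := ih hε; grind
  | orE _ _ _ iht ihu ihv =>
    simp only [Tree.subst, Tree.opens, Tree.exts, List.mem_append, mem_discharge] at hε ⊢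
    rcases hε with (hε | hε) | hε
    · have := iht hε; grind
    · rcases ihu hε with h | ⟨i, c, h1, h2⟩
      · grind
      · obtain ⟨k, rfl, h3⟩ := exists_of_mem_exts_liftSub h2
        exact .inr ⟨k, c, .inl (.inr h1), h3⟩
    · rcases ihv hε with h | ⟨i, c, h1, h2⟩
      · grind
      · obtain ⟨k, rfl, h3⟩ := exists_of_mem_exts_liftSub h2
        exact .inr ⟨k, c, .inr h1, h3⟩
  | impI _ ih =>
    simp only [Tree.subst, Tree.opens, Tree.exts, mem_discharge] at hε ⊢
    rcases ih hε with h | ⟨i, c, h1, h2⟩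
    · exact .inl h
    · obtain ⟨k, rfl, h3⟩ := exists_of_mem_exts_liftSub h2
      exact .inr ⟨k, c, h1, h3⟩
  | botI _ _ _ ih =>
    simp only [Tree.subst] at hε
    split_ifs at hε
    exacts [ih hε, ih hε]
  | @boxI _ _ _ _ α x _ hi he ih =>
    simp only [Tree.subst, Tree.opens, Tree.exts, List.mem_filter, decide_eq_true_eq] at hε ⊢
    rcases ih hε.1 with ⟨ζ, h1, rfl⟩ | ⟨i, c, h1, h2⟩
    · have hne : ζ ≠ α.snoc x := by
        rintro rfl
        exact hε.2 (Pos.update_self _ _ _)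
      exact .inl ⟨ζ, ⟨h1, hne⟩, Pos.update_of_not_prefix (he hS ζ h1 hne) _ _⟩
    · rw [PForm.map, Pos.update_of_not_prefix (hi _ h1)] at h2
      exact .inr ⟨i, c, h1, h2⟩
  | @diaE _ _ _ _ _ α x _ _ _ _ _ hi he iht ihu =>
    simp only [Tree.subst, Tree.opens, Tree.exts, List.mem_append, List.mem_filter,
      decide_eq_true_eq, mem_discharge] at hε ⊢
    rcases hε with hε | hε
    · have := iht hε; grind
    · rcases ihu hε.1 with ⟨ζ, h1, rfl⟩ | ⟨i, c, h1, h2⟩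
      · have hne : ζ ≠ α.snoc x := by
          rintro rfl
          exact hε.2 (Pos.update_self _ _ _)
        exact .inl ⟨ζ, .inr ⟨h1, hne⟩, Pos.update_of_not_prefix (he hS ζ h1 hne) _ _⟩
      · obtain ⟨k, rfl, h3⟩ := exists_of_mem_exts_liftSub h2
        rw [PForm.map, Pos.update_of_not_prefix (hi _ (mem_discharge.2 h1))] at h3
        exact .inr ⟨k, c, .inr h1, h3⟩

end

/-- All open assumptions of the tree have tokens below `n`. -/
def Tree.OpensBelow (n : ℕ) (t : Tree) : Prop :=
  (∀ p ∈ t.opens, p.2.pos.bound ≤ n) ∧ ∀ ε ∈ t.exts, ε.bound ≤ n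

theorem Tree.opensBelow_of_bound_le {n : ℕ} {t : Tree} (h : t.bound ≤ n) : t.OpensBelow n :=
  ⟨fun _ hp => (Tree.bound_of_mem_opens hp).trans h, fun _ hε => (Tree.bound_of_mem_exts hε).trans h⟩

theorem Tree.opensBelow_hyp {n i : ℕ} {a : PForm} (h : a.pos.bound ≤ n) :
    (Tree.hyp i a).OpensBelow n :=
  Tree.opensBelow_of_bound_le h

/-- For the assumption leaves `l`, whose positions are changed by `f`, the substitution `σ` yields
deductions whose open assumptions have tokens below `n`. -/
def DeductionSub (S : System) (n : ℕ) (f : Pos → Pos) (σ : ℕ → PForm → Tree)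
    (l : List (ℕ × PForm)) (Γ : List PForm) (Ξ : List Pos) : Prop :=
  ∀ i a, (i, a) ∈ l →
    (σ i (a.map f)).OpensBelow n ∧ IsDeduction S Γ Ξ (σ i (a.map f)) (a.map f)

section
variable {S : System} {n : ℕ} {f : Pos → Pos} {σ : ℕ → PForm → Tree} {l l' : List (ℕ × PForm)}
  {Γ : List PForm} {Ξ Ξ' : List Pos}

theorem DeductionSub.subset (h : DeductionSub S n f σ l Γ Ξ) (hl : l' ⊆ l) :
    DeductionSub S n f σ l' Γ Ξ := fun i a ha => h i a (hl ha)

theorem DeductionSub.lift (h : DeductionSub S n f σ (discharge l) Γ Ξ) {c : PForm}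
    (hc : ∀ b, (0, b) ∈ l → b.map f = c) (hn : c.pos.bound ≤ n) :
    DeductionSub S n f (liftSub σ) l (c :: Γ) Ξ
  | 0, a, ha => by
    rw [hc a ha]
    exact ⟨Tree.opensBelow_hyp hn, .hyp rfl⟩
  | i + 1, a, ha => by
    obtain ⟨⟨h1, h2⟩, h3⟩ := h i a (mem_discharge.2 ha)
    refine ⟨⟨fun ⟨j, b⟩ hp => ?_, fun ε hε => h2 ε ?_⟩, h3.succ c⟩
    · obtain ⟨k, hk, -⟩ := exists_of_mem_opens_rename hp
      exact h1 (k, b) hk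
    · rwa [liftSub, Tree.exts_rename] at hε

theorem DeductionSub.update (h : DeductionSub S n f σ l Γ Ξ) {u : Pos} (hu : NotInit u l)
    (v : Pos) : DeductionSub S (n + 1) (Pos.update f u v) σ l Γ (v :: Ξ) := by
  intro i a ha
  obtain ⟨⟨h1, h2⟩, h3⟩ := h i a ha
  rw [PForm.map, Pos.update_of_not_prefix (hu _ ha)]
  exact ⟨⟨fun p hp => (h1 p hp).trans n.le_succ, fun ε hε => (h2 ε hε).trans n.le_succ⟩,
    h3.mono_ext fun _ => List.subset_cons_self _ _⟩

end

section
variable {S : System} {Γ Γ' : List PForm} {Ξ Ξ' : List Pos} {t : Tree} {a : PForm}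

/-- Substitution of deductions for assumptions, together with a map of positions, yields
deductions. The side conditions survive because the proper positions become new: `m` bounds the
tokens of the tree, and `n` those of their images and of the assumptions that are put in. -/
theorem IsDeduction.subst (h : IsDeduction S Γ Ξ t a) {m n : ℕ} {f : Pos → Pos}
    {σ : ℕ → PForm → Tree} (hf : Respects S f) (hm : t.bound ≤ m) (hb : BoundedMap m n f)
    (hmn : m ≤ n) (hσ : DeductionSub S n f σ t.opens Γ' Ξ') (hΞ : S.IsPartial → ∀ ε ∈ t.exts, f ε ∈ Ξ') :
    IsDeduction S Γ' Ξ' (t.subst n f σ) (a.map f) := by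
  induction h generalizing n f σ Γ' Ξ' with
  | @hyp _ _ i a _ => exact (hσ i a (by simp [Tree.opens])).2
  | andI _ _ iht ihu =>
    simp only [Tree.opens, Tree.exts, Tree.bound, List.mem_append, max_le_iff] at *
    exact .andI
      (iht hf hm.1 hb hmn (hσ.subset (List.subset_append_left _ _)) fun hS ε h => hΞ hS ε (.inl h))
      (ihu hf hm.2 hb hmn (hσ.subset (List.subset_append_right _ _)) fun hS ε h => hΞ hS ε (.inr h))
  | andE1 _ ih => exact .andE1 (ih hf hm hb hmn hσ hΞ)
  | andE2 _ ih => exact .andE2 (ih hf hm hb hmn hσ hΞ)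
  | orI1 _ ih => exact .orI1 (ih hf hm hb hmn hσ hΞ)
  | orI2 _ ih => exact .orI2 (ih hf hm hb hmn hσ hΞ)
  | @orE _ _ _ _ _ A B α C β ht hu hv iht ihu ihv =>
    have hα := ht.bound_pos
    simp only [Tree.opens, Tree.exts, Tree.bound, List.mem_append, max_le_iff] at *
    refine .orE
      (iht hf hm.1 hb hmn (hσ.subset fun _ h => ?_) fun hS ε h => hΞ hS ε (.inl (.inl h)))
      (ihu hf hm.2.1 hb hmn ((hσ.subset fun _ h => ?_).lift (fun b h => ?_) ?_)
        fun hS ε h => hΞ hS ε (.inl (.inr h)))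
      (ihv hf hm.2.2 hb hmn ((hσ.subset fun _ h => ?_).lift (fun b h => ?_) ?_)
        fun hS ε h => hΞ hS ε (.inr h))
    · simp [h]
    · simp [h]
    · rw [hu.eq_of_mem_opens h]; rfl
    · exact hb _ (hα.trans hm.1)
    · simp [h]
    · rw [hv.eq_of_mem_opens h]; rfl
    · exact hb _ (hα.trans hm.1)
  | impI ht ih =>
    refine .impI (ih hf hm hb hmn (hσ.lift (fun b h => ?_) ?_) hΞ)
    · rw [ht.eq_of_mem_opens h]; rfl
    · exact hb _ (ht.bound_pos.trans hm)
  | impE _ _ iht ihu =>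
    simp only [Tree.opens, Tree.exts, Tree.bound, List.mem_append, max_le_iff] at *
    exact .impE
      (iht hf hm.1 hb hmn (hσ.subset (List.subset_append_left _ _)) fun hS ε h => hΞ hS ε (.inl h))
      (ihu hf hm.2 hb hmn (hσ.subset (List.subset_append_right _ _)) fun hS ε h => hΞ hS ε (.inr h))
  | @botI _ _ _ β A α _ ha _ ih =>
    simp only [Tree.bound, max_le_iff] at hm
    have := ih hf hm.2.2 hb hmn hσ hΞ
    simp only [Tree.subst]
    split_ifs with hc
    · obtain ⟨rfl, hc⟩ := hc
      rwa [PForm.map, ← hc] at this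
    · -- The application of `⊥_i` is kept exactly when its side condition still holds.
      exact .botI this ha fun h1 h2 => hc ⟨h1, h2⟩
  | @boxI _ _ t A α x ht hi he ih =>
    simp only [Tree.opens, Tree.exts, Tree.bound, List.mem_filter, decide_eq_true_eq,
      max_le_iff] at *
    have hα : (f α).bound ≤ n := hb _ ((Pos.bound_le_snoc _ _).trans hm.1)
    have hd : IsDeduction S Γ' ((f α).snoc n :: Ξ') _ _ :=
      ih (hf.update x (.inl rfl)) hm.2
        (hb.update (Pos.bound_snoc_le (hα.trans n.le_succ) n.lt_succ_self)
          (hmn.trans n.le_succ) n.le_succ) (hmn.trans n.le_succ)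
        (hσ.update hi _) ?_
    · refine .boxI (by simpa only [PForm.map, Pos.update_self] using hd) ?_ ?_
      · rintro ⟨j, b⟩ hp
        obtain ⟨i, c, h1, h2⟩ := ht.exists_of_mem_opens_subst hp
        rw [PForm.map, Pos.update_of_not_prefix (hi _ h1)] at h2
        exact Pos.not_snoc_prefix ((hσ i c h1).1.1 _ h2) _
      · intro hS ε hε hne
        rcases ht.exists_of_mem_exts_subst hS hε with ⟨ζ, h1, rfl⟩ | ⟨i, c, h1, h2⟩
        · have hζ : ζ ≠ α.snoc x := by
            rintro rfl
            exact hne (Pos.update_self _ _ _)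
          rw [Pos.update_of_not_prefix (he hS ζ h1 hζ)]
          exact Pos.not_snoc_prefix (hb _ ((Tree.bound_of_mem_exts h1).trans hm.2)) _
        · rw [PForm.map, Pos.update_of_not_prefix (hi _ h1)] at h2
          exact Pos.not_snoc_prefix ((hσ i c h1).1.2 _ h2) _
    · intro hS ε hε
      by_cases h : ε = α.snoc x
      · rw [h, Pos.update_self]; exact List.mem_cons_self
      · rw [Pos.update_of_not_prefix (he hS ε hε h)]
        exact List.mem_cons_of_mem _ (hΞ hS ε ⟨hε, h⟩)
  | boxE _ he hc _ ih =>
    simp only [Tree.exts, Tree.bound, List.mem_cons, max_le_iff] at *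
    obtain ⟨β', h1, h2⟩ := hf _ _ hc
    exact .boxE (ih hf hm.2 hb hmn hσ fun hS ε h => hΞ hS ε (.inr h)) (he ▸ h2) h1
      fun hS => hΞ hS _ (.inl rfl)
  | diaI _ he hc _ ih =>
    simp only [Tree.exts, Tree.bound, List.mem_cons, max_le_iff] at *
    obtain ⟨β', h1, h2⟩ := hf _ _ hc
    exact .diaI (ih hf hm.2.2 hb hmn hσ fun hS ε h => hΞ hS ε (.inr h)) (he ▸ h2) h1
      fun hS => hΞ hS _ (.inl rfl)
  | @diaE _ _ t u A α x C γ ht hu hn hi he iht ihu =>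
    simp only [Tree.opens, Tree.exts, Tree.bound, List.mem_append, List.mem_filter,
      decide_eq_true_eq, max_le_iff] at *
    have hα : (f α).bound ≤ n := hb _ ((Pos.bound_le_snoc _ _).trans hm.1)
    have hσu : DeductionSub S n f σ (discharge u.opens) Γ' Ξ' :=
      hσ.subset (List.subset_append_right _ _)
    have hd : IsDeduction S (⟨A, (f α).snoc n⟩ :: Γ') ((f α).snoc n :: Ξ') _ _ :=
      ihu (hf.update x (.inl rfl)) hm.2.2
        (hb.update (Pos.bound_snoc_le (hα.trans n.le_succ) n.lt_succ_self)
          (hmn.trans n.le_succ) n.le_succ) (hmn.trans n.le_succ)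
        ((hσu.update hi _).lift (fun b h => ?_)
          (Pos.bound_snoc_le (hα.trans n.le_succ) n.lt_succ_self)) ?_
    · -- The side condition on the conclusion says that renaming `αx` does not move it.
      rw [PForm.map, Pos.update_of_not_prefix hn] at hd
      refine .diaE (iht hf hm.2.1 hb hmn (hσ.subset (List.subset_append_left _ _))
        fun hS ε h => hΞ hS ε (.inl h)) hd ?_ ?_ ?_
      · exact Pos.not_snoc_prefix (hb _ (hu.bound_pos.trans hm.2.2)) _
      · rintro ⟨j, b⟩ hp
        obtain ⟨i, c, h1, h2⟩ := hu.exists_of_mem_opens_subst (mem_discharge.1 hp)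
        obtain ⟨k, rfl, h3⟩ := exists_of_mem_opens_liftSub h2
        have h1 := mem_discharge.2 h1
        rw [PForm.map, Pos.update_of_not_prefix (hi _ h1)] at h3
        exact Pos.not_snoc_prefix ((hσu k c h1).1.1 _ h3) _
      · intro hS ε hε hne
        rcases hu.exists_of_mem_exts_subst hS hε with ⟨ζ, h1, rfl⟩ | ⟨i, c, h1, h2⟩
        · have hζ : ζ ≠ α.snoc x := by
            rintro rfl
            exact hne (Pos.update_self _ _ _)
          rw [Pos.update_of_not_prefix (he hS ζ h1 hζ)]
          exact Pos.not_snoc_prefix (hb _ ((Tree.bound_of_mem_exts h1).trans hm.2.2)) _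
        · obtain ⟨k, rfl, h3⟩ := exists_of_mem_exts_liftSub h2
          have h1 := mem_discharge.2 h1
          rw [PForm.map, Pos.update_of_not_prefix (hi _ h1)] at h3
          exact Pos.not_snoc_prefix ((hσu k c h1).1.2 _ h3) _
    · rw [hu.eq_of_mem_opens h, PForm.map, Pos.update_self]
    · intro hS ε hε
      by_cases h : ε = α.snoc x
      · rw [h, Pos.update_self]; exact List.mem_cons_self
      · rw [Pos.update_of_not_prefix (he hS ε hε h)]
        exact List.mem_cons_of_mem _ (hΞ hS ε (.inr ⟨hε, h⟩))

end

/-! ### Reduction preserves deductions -/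

section
variable {S : System} {Γ Γ' : List PForm} {Ξ Ξ' : List Pos} {t u t' : Tree} {a b c : PForm}

theorem append_subset_append {X : Type*} {k k' l l' : List X} (h : k ⊆ k') (h' : l ⊆ l') :
    k ++ l ⊆ k' ++ l' :=
  List.append_subset.2 ⟨List.subset_append_of_subset_left _ h,
    List.subset_append_of_subset_right _ h'⟩

/-- `t'` is a deduction of `a`, and its open assumptions are among those of `t`. The latter is needed
for the side conditions of the rules that are applied below `t`. -/
structure Refines (S : System) (Γ : List PForm) (Ξ : List Pos) (t t' : Tree) (a : PForm) :
    Prop where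
  isDeduction : IsDeduction S Γ Ξ t' a
  opens : t'.opens ⊆ t.opens
  exts : S.IsPartial → t'.exts ⊆ t.exts

/-- A substitution for the discharged assumption `c` only, where `f` moves no open assumption. -/
theorem IsDeduction.subst_single (hu : IsDeduction S (c :: Γ) Ξ' u b) {n : ℕ} {f : Pos → Pos}
    (hf : Respects S f) (hn : u.bound ≤ n) (hb : BoundedMap n n f)
    (ht : IsDeduction S Γ Ξ t (c.map f)) (htn : t.bound ≤ n)
    (hi : ∀ i d, (i, d) ∈ discharge u.opens → f d.pos = d.pos)
    (hΞ : S.IsPartial → ∀ ε ∈ u.exts, f ε ∈ Ξ) :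
    IsDeduction S Γ Ξ (u.subst n f (single t)) (b.map f) ∧
      (u.subst n f (single t)).opens ⊆ t.opens ++ discharge u.opens ∧
      (S.IsPartial → (u.subst n f (single t)).exts ⊆ t.exts ++ u.exts.map f) := by
  refine ⟨hu.subst hf hn hb le_rfl ?_ hΞ, ?_, ?_⟩
  · rintro (_ | i) d hd
    · rw [hu.eq_of_mem_opens hd]
      exact ⟨Tree.opensBelow_of_bound_le htn, ht⟩
    · refine ⟨Tree.opensBelow_hyp (hb _ ((Tree.bound_of_mem_opens hd).trans hn)), .hyp ?_⟩
      rw [PForm.map, hi i d (mem_discharge.2 hd)]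
      simpa using hu.getElem?_of_mem_opens hd
  · rintro ⟨j, d⟩ hd
    obtain ⟨_ | i, e, h1, h2⟩ := hu.exists_of_mem_opens_subst hd
    · exact List.mem_append_left _ h2
    · have h1 := mem_discharge.2 h1
      rw [PForm.map, hi i e h1] at h2
      obtain ⟨rfl, rfl⟩ : j = i ∧ d = e := by simpa [single, Tree.opens] using h2
      exact List.mem_append_right _ h1
  · intro hS ε hε
    rcases hu.exists_of_mem_exts_subst hS hε with ⟨ζ, h1, rfl⟩ | ⟨_ | i, e, h1, h2⟩
    · exact List.mem_append_right _ (List.mem_map_of_mem h1)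
    · exact List.mem_append_left _ h2
    · simp [single, Tree.exts] at h2

/-- A substitution that changes positions only. -/
theorem IsDeduction.subst_hyp (ht : IsDeduction S Γ Ξ t a) {m n : ℕ} {f : Pos → Pos}
    (hf : Respects S f) (hm : t.bound ≤ m) (hb : BoundedMap m n f) (hmn : m ≤ n)
    (hΓ : ∀ i d, (i, d) ∈ t.opens → Γ'[i]? = some (d.map f))
    (hΞ : S.IsPartial → ∀ ε ∈ t.exts, f ε ∈ Ξ') :
    IsDeduction S Γ' Ξ' (t.subst n f .hyp) (a.map f) ∧
      (∀ p ∈ (t.subst n f .hyp).opens, ∃ d, (p.1, d) ∈ t.opens ∧ p.2 = d.map f) ∧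
      (S.IsPartial → (t.subst n f .hyp).exts ⊆ t.exts.map f) := by
  refine ⟨ht.subst hf hm hb hmn (fun i d hd => ?_) hΞ, ?_, ?_⟩
  · exact ⟨Tree.opensBelow_hyp (hb _ ((Tree.bound_of_mem_opens hd).trans hm)), .hyp (hΓ i d hd)⟩
  · rintro ⟨j, d⟩ hd
    obtain ⟨i, e, h1, h2⟩ := ht.exists_of_mem_opens_subst hd
    obtain ⟨rfl, rfl⟩ : j = i ∧ d = e.map f := by simpa [Tree.opens] using h2
    exact ⟨e, h1, rfl⟩
  · intro hS ε hε
    rcases ht.exists_of_mem_exts_subst hS hε with ⟨ζ, h1, rfl⟩ | ⟨i, e, h1, h2⟩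
    · exact List.mem_map_of_mem h1
    · simp [Tree.exts] at h2

/-- `R.IsDeduction S Γ Ξ a b`: the elimination `R` leads from a deduction of `a` to a deduction of
`b`. -/
inductive Elim.IsDeduction (S : System) (Γ : List PForm) (Ξ : List Pos) :
    Elim → PForm → PForm → Prop
  | andE1 {A B α} : Elim.IsDeduction S Γ Ξ .andE1 ⟨.and A B, α⟩ ⟨A, α⟩
  | andE2 {A B α} : Elim.IsDeduction S Γ Ξ .andE2 ⟨.and A B, α⟩ ⟨B, α⟩
  | orE {u v A B α C β} : PosND.IsDeduction S (⟨A, α⟩ :: Γ) Ξ u ⟨C, β⟩ →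
      PosND.IsDeduction S (⟨B, α⟩ :: Γ) Ξ v ⟨C, β⟩ →
      Elim.IsDeduction S Γ Ξ (.orE u v) ⟨.or A B, α⟩ ⟨C, β⟩
  | impE {u A B α} : PosND.IsDeduction S Γ Ξ u ⟨A, α⟩ →
      Elim.IsDeduction S Γ Ξ (.impE u) ⟨.imp A B, α⟩ ⟨B, α⟩
  | boxE {A α β ε} : ε = α ++ β → S.Constraint β → (S.IsPartial → ε ∈ Ξ) →
      Elim.IsDeduction S Γ Ξ (.boxE ε) ⟨.box A, α⟩ ⟨A, ε⟩
  | diaE {u A α x C γ} :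
      PosND.IsDeduction S (⟨A, α.snoc x⟩ :: Γ) (α.snoc x :: Ξ) u ⟨C, γ⟩ →
      ¬ α.snoc x <+: γ → NotInit (α.snoc x) (discharge u.opens) →
      NotInitExt S (α.snoc x) u.exts →
      Elim.IsDeduction S Γ Ξ (.diaE α x u) ⟨.dia A, α⟩ ⟨C, γ⟩

theorem Elim.IsDeduction.apply {R : Elim} (hR : R.IsDeduction S Γ Ξ a b)
    (ht : PosND.IsDeduction S Γ Ξ t a) : PosND.IsDeduction S Γ Ξ (R.apply t) b := by
  cases hR with
  | andE1 => exact .andE1 ht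
  | andE2 => exact .andE2 ht
  | orE hu hv => exact .orE ht hu hv
  | impE hu => exact .impE ht hu
  | boxE he hc hS => exact .boxE ht he hc hS
  | diaE hu hn hi he => exact .diaE ht hu hn hi he

theorem IsDeduction.exists_of_apply {R : Elim} (h : IsDeduction S Γ Ξ (R.apply t) b) :
    ∃ a, IsDeduction S Γ Ξ t a ∧ R.IsDeduction S Γ Ξ a b := by
  cases R with
  | andE1 => cases h with | andE1 ht => exact ⟨_, ht, .andE1⟩
  | andE2 => cases h with | andE2 ht => exact ⟨_, ht, .andE2⟩
  | orE u v => cases h with | orE ht hu hv => exact ⟨_, ht, .orE hu hv⟩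
  | impE u => cases h with | impE ht hu => exact ⟨_, ht, .impE hu⟩
  | boxE ε => cases h with | boxE ht he hc hS => exact ⟨_, ht, .boxE he hc hS⟩
  | diaE α x u => cases h with | diaE ht hu hn hi he => exact ⟨_, ht, .diaE hu hn hi he⟩

theorem Elim.IsDeduction.raise {R : Elim} (hR : R.IsDeduction S Γ Ξ a b) (c : PForm)
    (hΞ : Ξ ⊆ Ξ') : R.raise.IsDeduction S (c :: Γ) Ξ' a b := by
  cases hR with
  | andE1 => exact .andE1
  | andE2 => exact .andE2
  | orE hu hv => exact .orE (hu.lift_succ c fun _ => hΞ) (hv.lift_succ c fun _ => hΞ)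
  | impE hu => exact .impE ((hu.succ c).mono_ext fun _ => hΞ)
  | boxE he hc hS => exact .boxE he hc fun h => hΞ (hS h)
  | diaE hu hn hi he =>
    refine .diaE (hu.lift_succ c fun _ => List.cons_subset_cons _ hΞ) hn
      (hi.mono fun i d hd => ?_) (by rwa [Tree.exts_rename])
    obtain ⟨_ | j, hj, e⟩ := exists_of_mem_opens_rename (mem_discharge.1 hd)
    · simp [liftRen] at e
    · exact ⟨j, mem_discharge.2 hj⟩

/-- The open assumptions of the minor premisses. -/
def Elim.opens : Elim → List (ℕ × PForm)
  | .andE1 => []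
  | .andE2 => []
  | .orE u v => discharge u.opens ++ discharge v.opens
  | .impE u => u.opens
  | .boxE _ => []
  | .diaE _ _ u => discharge u.opens

/-- The open existence assumptions that the elimination adds. -/
def Elim.exts : Elim → List Pos
  | .andE1 => []
  | .andE2 => []
  | .orE u v => u.exts ++ v.exts
  | .impE u => u.exts
  | .boxE ε => [ε]
  | .diaE α x u => u.exts.filter fun ε => ε ≠ α.snoc x

theorem Elim.mem_opens_apply {R : Elim} {p : ℕ × PForm} :
    p ∈ (R.apply t).opens ↔ p ∈ t.opens ∨ p ∈ R.opens := by
  cases R <;> simp [Elim.apply, Elim.opens, Tree.opens]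

theorem Elim.mem_exts_apply {R : Elim} {ε : Pos} :
    ε ∈ (R.apply t).exts ↔ ε ∈ t.exts ∨ ε ∈ R.exts := by
  cases R <;> simp [Elim.apply, Elim.exts, Tree.exts, or_comm]

theorem Elim.exts_raise (R : Elim) : R.raise.exts = R.exts := by
  cases R <;> simp [Elim.raise, Elim.exts, Tree.exts_rename]

theorem Elim.bound_le_apply (R : Elim) (t : Tree) : t.bound ≤ (R.apply t).bound := by
  cases R <;> simp [Elim.apply, Tree.bound]

theorem mem_discharge_rename_liftRen {i : ℕ}
    (h : (i + 1, a) ∈ discharge (t.rename (liftRen Nat.succ)).opens) :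
    (i, a) ∈ discharge t.opens := by
  obtain ⟨_ | j, hj, e⟩ := exists_of_mem_opens_rename (mem_discharge.1 h)
  · simp [liftRen] at e
  · obtain rfl : i = j := by simpa [liftRen] using e
    exact mem_discharge.2 hj

theorem Elim.mem_opens_of_raise {R : Elim} {i : ℕ} (h : (i + 1, a) ∈ R.raise.opens) :
    (i, a) ∈ R.opens := by
  cases R with
  | orE u v =>
    rcases List.mem_append.1 h with h | h
    · exact List.mem_append_left _ (mem_discharge_rename_liftRen h)
    · exact List.mem_append_right _ (mem_discharge_rename_liftRen h)
  | impE u =>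
    obtain ⟨j, hj, e⟩ := exists_of_mem_opens_rename h
    exact Nat.succ.inj e ▸ hj
  | diaE α x u => exact mem_discharge_rename_liftRen h
  | _ => simp [Elim.raise, Elim.opens] at h

theorem mem_opens_of_discharge_raise {R : Elim} {i : ℕ}
    (h : (i, a) ∈ discharge (R.raise.apply t).opens) :
    (i, a) ∈ discharge t.opens ∨ (i, a) ∈ R.opens := by
  rw [mem_discharge, Elim.mem_opens_apply] at h
  exact h.imp mem_discharge.2 Elim.mem_opens_of_raise

theorem PForm.map_replace_of_not_prefix {π ρ : Pos} (h : ¬ π <+: a.pos) :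
    a.map (Pos.replace π ρ) = a := by
  rw [PForm.map, Pos.replace, Pos.update_of_not_prefix h]; rfl

theorem PForm.map_replace_self (A : Fml) (π ρ : Pos) :
    PForm.map (Pos.replace π ρ) ⟨A, π⟩ = ⟨A, ρ⟩ := by
  rw [PForm.map, Pos.replace, Pos.update_self]

/-- Replacing a proper position affects only the existence assumptions that its rule discharges. -/
theorem NotInitExt.replace_eq {π : Pos} {l : List Pos} (h : NotInitExt S π l) (hS : S.IsPartial)
    (ρ : Pos) {ζ : Pos} (hζ : ζ ∈ l) :
    ζ = π ∧ Pos.replace π ρ ζ = ρ ∨ ζ ≠ π ∧ Pos.replace π ρ ζ = ζ := by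
  by_cases e : ζ = π
  · exact .inl ⟨e, e ▸ Pos.update_self _ _ _⟩
  · exact .inr ⟨e, Pos.update_of_not_prefix (h hS ζ hζ e) _ _⟩

/-- The common part of the proper contractions for `∨` and `→`. -/
theorem refines_single_id (hu : IsDeduction S (c :: Γ) Ξ u b) (ht : IsDeduction S Γ Ξ t c)
    {n : ℕ} (hun : u.bound ≤ n) (htn : t.bound ≤ n) {s : Tree}
    (ho : t.opens ++ discharge u.opens ⊆ s.opens) (he : t.exts ++ u.exts ⊆ s.exts) :
    Refines S Γ Ξ s (u.subst n id (single t)) b := by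
  obtain ⟨h1, h2, h3⟩ := hu.subst_single (respects_id S) hun (boundedMap_id n) ht htn
    (fun _ _ _ => rfl) fun hS _ hε => hu.mem_of_mem_exts hS hε
  rw [List.map_id] at h3
  exact ⟨h1, fun _ hp => ho (h2 hp), fun hS _ hε => he (h3 hS hε)⟩

theorem respects_replace {α β : Pos} (x : ℕ) (h : S.Constraint β) :
    Respects S (Pos.replace (α.snoc x) (α ++ β)) :=
  (respects_id S).update x (.inr h)

theorem refines_box {A : Fml} {α ε : Pos} {x : ℕ}
    (h : IsDeduction S Γ Ξ (.boxE ε (.boxI α x t)) ⟨A, ε⟩) :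
    Refines S Γ Ξ (.boxE ε (.boxI α x t))
      (t.subst (Tree.boxE ε (.boxI α x t)).bound (Pos.replace (α.snoc x) ε) .hyp) ⟨A, ε⟩ := by
  have hn : ε.bound ≤ (Tree.boxE ε (.boxI α x t)).bound := le_max_left _ _
  have ht' : t.bound ≤ (Tree.boxE ε (.boxI α x t)).bound :=
    le_max_of_le_right (le_max_right _ _)
  generalize (Tree.boxE ε (.boxI α x t)).bound = n at hn ht' ⊢
  cases h with
  | boxE h heq hc hS' =>
  cases h with
  | boxI ht hi he =>
  have hf := respects_replace (α := α) x hc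
  rw [← heq] at hf
  have hmap : ∀ i d, (i, d) ∈ t.opens → d.map (Pos.replace (α.snoc x) ε) = d := fun i d hd =>
    PForm.map_replace_of_not_prefix (hi _ hd)
  obtain ⟨h1, h2, h3⟩ := ht.subst_hyp (Γ' := Γ) (Ξ' := Ξ) hf ht'
    ((boundedMap_id _).update hn le_rfl le_rfl) le_rfl
    (fun i d hd => by rw [hmap i d hd]; exact ht.getElem?_of_mem_opens hd)
    (fun hS ζ hζ => by
      rcases he.replace_eq hS _ hζ with ⟨-, e⟩ | ⟨hne, e⟩ <;> rw [e]
      · exact hS' hS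
      · exact (List.mem_cons.1 (ht.mem_of_mem_exts hS hζ)).resolve_left hne)
  rw [PForm.map_replace_self] at h1
  refine ⟨h1, ?_, ?_⟩
  · rintro p hp
    obtain ⟨d, hd, e⟩ := h2 p hp
    rw [hmap _ d hd] at e
    exact (show p = (p.1, d) from Prod.ext rfl e) ▸ hd
  · intro hS ζ hζ
    obtain ⟨η, hη, rfl⟩ := List.mem_map.1 (h3 hS hζ)
    rcases he.replace_eq hS _ hη with ⟨-, e⟩ | ⟨hne, e⟩ <;> rw [e] <;> simp_all [Tree.exts]

theorem refines_dia {α ε : Pos} {x : ℕ}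
    (h : IsDeduction S Γ Ξ (.diaE α x (.diaI α ε t) u) b) :
    Refines S Γ Ξ (.diaE α x (.diaI α ε t) u)
      (u.subst (Tree.diaE α x (.diaI α ε t) u).bound (Pos.replace (α.snoc x) ε) (single t))
      b := by
  have hn : ε.bound ≤ (Tree.diaE α x (.diaI α ε t) u).bound := by simp [Tree.bound]
  have ht' : t.bound ≤ (Tree.diaE α x (.diaI α ε t) u).bound := by simp [Tree.bound]
  have hu' : u.bound ≤ (Tree.diaE α x (.diaI α ε t) u).bound := by simp [Tree.bound]
  generalize (Tree.diaE α x (.diaI α ε t) u).bound = n at hn ht' hu' ⊢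
  cases h with
  | diaE h hu hγ hi he =>
  cases h with
  | diaI ht heq hc hS' =>
  have hf := respects_replace (α := α) x hc
  rw [← heq] at hf
  obtain ⟨h1, h2, h3⟩ := hu.subst_single (Γ := Γ) (Ξ := Ξ) hf hu'
    ((boundedMap_id _).update hn le_rfl le_rfl)
    (by rw [PForm.map_replace_self]; exact ht) ht'
    (fun i d hd => Pos.update_of_not_prefix (hi _ hd) _ _)
    (fun hS ζ hζ => by
      rcases he.replace_eq hS _ hζ with ⟨-, e⟩ | ⟨hne, e⟩ <;> rw [e]
      · exact hS' hS
      · exact (List.mem_cons.1 (hu.mem_of_mem_exts hS hζ)).resolve_left hne)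
  rw [PForm.map_replace_of_not_prefix hγ] at h1
  refine ⟨h1, h2, ?_⟩
  intro hS ζ hζ
  rcases List.mem_append.1 (h3 hS hζ) with hζ | hζ
  · simp [Tree.exts, hζ]
  · obtain ⟨η, hη, rfl⟩ := List.mem_map.1 hζ
    rcases he.replace_eq hS _ hη with ⟨-, e⟩ | ⟨hne, e⟩ <;> rw [e] <;> simp_all [Tree.exts]

theorem refines_commOr {v : Tree} {R : Elim} (h : IsDeduction S Γ Ξ (R.apply (.orE t u v)) b) :
    Refines S Γ Ξ (R.apply (.orE t u v)) (.orE t (R.raise.apply u) (R.raise.apply v)) b := by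
  obtain ⟨a, h, hR⟩ := h.exists_of_apply
  cases h with
  | orE ht hu hv =>
  refine ⟨.orE ht ((hR.raise _ (List.Subset.refl _)).apply hu)
    ((hR.raise _ (List.Subset.refl _)).apply hv), ?_, fun _ => ?_⟩
  · rintro ⟨i, d⟩ hd
    rw [Elim.mem_opens_apply]
    simp only [Tree.opens, List.mem_append] at hd ⊢
    rcases hd with (hd | hd) | hd
    · exact .inl (.inl (.inl hd))
    · rcases mem_opens_of_discharge_raise hd with hd | hd
      · exact .inl (.inl (.inr hd))
      · exact .inr hd
    · rcases mem_opens_of_discharge_raise hd with hd | hd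
      · exact .inl (.inr hd)
      · exact .inr hd
  · intro ε hε
    simp only [Tree.exts, List.mem_append, Elim.mem_exts_apply, Elim.exts_raise] at hε ⊢
    grind

/-- The new proper position `αn` fulfils the side conditions of `◇E` also for the minor premisses and
the conclusion of `R`, since `n` exceeds all tokens of the contracted tree. -/
theorem refines_commDia {α : Pos} {x n : ℕ} {R : Elim}
    (h : IsDeduction S Γ Ξ (R.apply (.diaE α x t u)) b)
    (hn : n = (R.apply (.diaE α x t u)).bound) :
    Refines S Γ Ξ (R.apply (.diaE α x t u))
      (.diaE α n t (R.raise.apply (u.subst (n + 1) (Pos.replace (α.snoc x) (α.snoc n)) .hyp)))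
      b := by
  have hb := hn ▸ h.bound_pos
  have hD : (Tree.diaE α x t u).bound ≤ n := hn ▸ R.bound_le_apply _
  have hu' : u.bound ≤ n := le_trans (by simp [Tree.bound]) hD
  have hα : α.bound ≤ n :=
    (Pos.bound_le_snoc α x).trans (le_trans (by simp [Tree.bound]) hD)
  obtain ⟨hbo, hbe⟩ := Tree.opensBelow_of_bound_le hn.ge
  obtain ⟨a, h, hR⟩ := h.exists_of_apply
  cases h with
  | diaE ht hu hγ hi he =>
  have hf : Respects S (Pos.replace (α.snoc x) (α.snoc n)) :=
    (respects_id S).update (δ := [n]) x (.inl rfl)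
  obtain ⟨h1, h2, h3⟩ := hu.subst_hyp (Γ' := ⟨_, α.snoc n⟩ :: Γ) (Ξ' := α.snoc n :: Ξ) hf hu'
    ((boundedMap_id n).update (Pos.bound_snoc_le (hα.trans n.le_succ) n.lt_succ_self) n.le_succ
      n.le_succ) n.le_succ
    (by
      rintro (_ | i) d hd
      · rw [hu.eq_of_mem_opens hd, PForm.map_replace_self]; rfl
      · rw [PForm.map_replace_of_not_prefix (hi _ (mem_discharge.2 hd))]
        simpa using hu.getElem?_of_mem_opens hd)
    (fun hS ζ hζ => by
      rcases he.replace_eq hS _ hζ with ⟨-, e⟩ | ⟨hne, e⟩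
      · exact List.mem_cons.2 (.inl e)
      · exact List.mem_cons.2 (.inr (e.symm ▸
          (List.mem_cons.1 (hu.mem_of_mem_exts hS hζ)).resolve_left hne)))
  rw [PForm.map_replace_of_not_prefix hγ] at h1
  have hopens : discharge (R.raise.apply
      (u.subst (n + 1) (Pos.replace (α.snoc x) (α.snoc n)) .hyp)).opens ⊆
      (R.apply (.diaE α x t u)).opens := by
    rintro ⟨i, d⟩ hd
    rw [Elim.mem_opens_apply]
    rcases mem_opens_of_discharge_raise hd with hd | hd
    · obtain ⟨d', hd', e⟩ := h2 _ (mem_discharge.1 hd)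
      have hd' := mem_discharge.2 hd'
      rw [PForm.map_replace_of_not_prefix (hi _ hd')] at e
      exact .inl (List.mem_append_right _ (by rwa [show d = d' from e]))
    · exact .inr hd
  have hexts : S.IsPartial → ∀ ζ ∈ (R.raise.apply
      (u.subst (n + 1) (Pos.replace (α.snoc x) (α.snoc n)) .hyp)).exts, ζ ≠ α.snoc n →
      ζ ∈ (R.apply (.diaE α x t u)).exts := by
    intro hS ζ hζ hne
    rw [Elim.mem_exts_apply, Elim.exts_raise] at hζ
    rw [Elim.mem_exts_apply]
    rcases hζ with hζ | hζ
    · obtain ⟨η, hη, rfl⟩ := List.mem_map.1 (h3 hS hζ)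
      rcases he.replace_eq hS _ hη with ⟨-, e⟩ | ⟨hne', e⟩
      · exact absurd e hne
      · rw [e]
        exact .inl (List.mem_append_right _ (List.mem_filter.2 ⟨hη, by simpa using hne'⟩))
    · exact .inr hζ
  refine ⟨.diaE ht ((hR.raise _ (List.subset_cons_self _ _)).apply h1)
    (Pos.not_snoc_prefix hb _) (fun p hp => Pos.not_snoc_prefix (hbo p (hopens hp)) _)
    (fun hS ζ hζ hne => Pos.not_snoc_prefix (hbe ζ (hexts hS ζ hζ hne)) _), ?_, fun hS ζ hζ => ?_⟩
  · intro p hp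
    rcases List.mem_append.1 hp with hp | hp
    · exact Elim.mem_opens_apply.2 (.inl (List.mem_append_left _ hp))
    · exact hopens hp
  · rcases List.mem_append.1 hζ with hζ | hζ
    · exact Elim.mem_exts_apply.2 (.inl (List.mem_append_left _ hζ))
    · have := List.mem_filter.1 hζ
      exact hexts hS ζ this.1 (by simpa using this.2)

theorem Contracts.refines (hc : Contracts t t') (h : IsDeduction S Γ Ξ t a) :
    Refines S Γ Ξ t t' a := by
  cases hc with
  | and1 t u =>
    cases h with | andE1 h => cases h with | andI ht hu =>
    exact ⟨ht, List.subset_append_left _ _, fun _ => List.subset_append_left _ _⟩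
  | and2 t u =>
    cases h with | andE2 h => cases h with | andI ht hu =>
    exact ⟨hu, List.subset_append_right _ _, fun _ => List.subset_append_right _ _⟩
  | or1 B t u v =>
    cases h with | orE h hu hv => cases h with | orI1 ht =>
    exact refines_single_id hu ht (by simp [Tree.bound]) (by simp [Tree.bound])
      (fun p hp => by simp_all [Tree.opens]; tauto) (fun p hp => by simp_all [Tree.exts]; tauto)
  | or2 A t u v =>
    cases h with | orE h hu hv => cases h with | orI2 ht =>
    exact refines_single_id hv ht (by simp [Tree.bound]) (by simp [Tree.bound])
      (fun p hp => by simp_all [Tree.opens]; tauto) (fun p hp => by simp_all [Tree.exts]; tauto)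
  | imp A t u =>
    cases h with | impE h hu => cases h with | impI ht =>
    exact refines_single_id ht hu (by simp [Tree.bound]) (by simp [Tree.bound])
      (fun p hp => by simp_all [Tree.opens]; tauto) (fun p hp => by simp_all [Tree.exts]; tauto)
  | box α x ε t =>
    obtain ⟨A, rfl⟩ : ∃ A, a = ⟨A, ε⟩ := by cases h; exact ⟨_, rfl⟩
    exact refines_box h
  | dia α x ε t u => exact refines_dia h
  | commOr t u v R => exact refines_commOr h
  | commDia α x t u R n hn => exact refines_commDia h hn

/-- In a deduction every loose step is a step, and it leads to a deduction. -/
theorem LooseStep.refines (hs : LooseStep t t') (h : IsDeduction S Γ Ξ t a) :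
    Step t t' ∧ Refines S Γ Ξ t t' a := by
  induction hs generalizing Γ Ξ a with
  | contract hc =>
    cases hc with
    | of hc => exact ⟨.contract hc, hc.refines h⟩
    | dia α x β ε t u =>
      obtain rfl : β = α := by
        cases h with | diaE h _ _ _ _ => cases h with | diaI _ _ _ _ => rfl
      exact ⟨.contract (.dia _ _ _ _ _), refines_dia h⟩
  | andI_left _ ih =>
    cases h with | andI ht hu =>
    obtain ⟨h1, h2, h3, h4⟩ := ih ht
    exact ⟨.andI_left h1, .andI h2 hu, append_subset_append h3 (List.Subset.refl _),
      fun hS => append_subset_append (h4 hS) (List.Subset.refl _)⟩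
  | andI_right _ ih =>
    cases h with | andI ht hu =>
    obtain ⟨h1, h2, h3, h4⟩ := ih hu
    exact ⟨.andI_right h1, .andI ht h2, append_subset_append (List.Subset.refl _) h3,
      fun hS => append_subset_append (List.Subset.refl _) (h4 hS)⟩
  | andE1 _ ih =>
    cases h with | andE1 ht =>
    obtain ⟨h1, h2, h3, h4⟩ := ih ht
    exact ⟨.andE1 h1, .andE1 h2, h3, h4⟩
  | andE2 _ ih =>
    cases h with | andE2 ht =>
    obtain ⟨h1, h2, h3, h4⟩ := ih ht
    exact ⟨.andE2 h1, .andE2 h2, h3, h4⟩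
  | orI1 _ ih =>
    cases h with | orI1 ht =>
    obtain ⟨h1, h2, h3, h4⟩ := ih ht
    exact ⟨.orI1 h1, .orI1 h2, h3, h4⟩
  | orI2 _ ih =>
    cases h with | orI2 ht =>
    obtain ⟨h1, h2, h3, h4⟩ := ih ht
    exact ⟨.orI2 h1, .orI2 h2, h3, h4⟩
  | orE_major _ ih =>
    cases h with | orE ht hu hv =>
    obtain ⟨h1, h2, h3, h4⟩ := ih ht
    refine ⟨.orE_major h1, .orE h2 hu hv, ?_, fun hS => ?_⟩
    · exact append_subset_append (append_subset_append h3 (List.Subset.refl _))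
        (List.Subset.refl _)
    · exact append_subset_append (append_subset_append (h4 hS) (List.Subset.refl _))
        (List.Subset.refl _)
  | orE_left _ ih =>
    cases h with | orE ht hu hv =>
    obtain ⟨h1, h2, h3, h4⟩ := ih hu
    refine ⟨.orE_left h1, .orE ht h2 hv, ?_, fun hS => ?_⟩
    · exact append_subset_append
        (append_subset_append (List.Subset.refl _) (discharge_subset h3))
        (List.Subset.refl _)
    · exact append_subset_append (append_subset_append (List.Subset.refl _) (h4 hS))
        (List.Subset.refl _)
  | orE_right _ ih =>
    cases h with | orE ht hu hv =>
    obtain ⟨h1, h2, h3, h4⟩ := ih hv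
    refine ⟨.orE_right h1, .orE ht hu h2, ?_, fun hS => ?_⟩
    · exact append_subset_append (List.Subset.refl _) (discharge_subset h3)
    · exact append_subset_append (List.Subset.refl _) (h4 hS)
  | impI _ ih =>
    cases h with | impI ht =>
    obtain ⟨h1, h2, h3, h4⟩ := ih ht
    exact ⟨.impI h1, .impI h2, discharge_subset h3, h4⟩
  | impE_major _ ih =>
    cases h with | impE ht hu =>
    obtain ⟨h1, h2, h3, h4⟩ := ih ht
    exact ⟨.impE_major h1, .impE h2 hu, append_subset_append h3 (List.Subset.refl _),
      fun hS => append_subset_append (h4 hS) (List.Subset.refl _)⟩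
  | impE_minor _ ih =>
    cases h with | impE ht hu =>
    obtain ⟨h1, h2, h3, h4⟩ := ih hu
    exact ⟨.impE_minor h1, .impE ht h2, append_subset_append (List.Subset.refl _) h3,
      fun hS => append_subset_append (List.Subset.refl _) (h4 hS)⟩
  | botI _ ih =>
    cases h with | botI ht ha hne =>
    obtain ⟨h1, h2, h3, h4⟩ := ih ht
    exact ⟨.botI h1, .botI h2 ha hne, h3, h4⟩
  | boxI _ ih =>
    cases h with | boxI ht hi he =>
    obtain ⟨h1, h2, h3, h4⟩ := ih ht
    exact ⟨.boxI h1, .boxI h2 (fun p hp => hi p (h3 hp)) (fun hS ε hε => he hS ε (h4 hS hε)),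
      h3, fun hS => List.filter_subset _ (h4 hS)⟩
  | boxE _ ih =>
    cases h with | boxE ht he hc hS' =>
    obtain ⟨h1, h2, h3, h4⟩ := ih ht
    exact ⟨.boxE h1, .boxE h2 he hc hS', h3, fun hS => List.cons_subset_cons _ (h4 hS)⟩
  | diaI _ ih =>
    cases h with | diaI ht he hc hS' =>
    obtain ⟨h1, h2, h3, h4⟩ := ih ht
    exact ⟨.diaI h1, .diaI h2 he hc hS', h3, fun hS => List.cons_subset_cons _ (h4 hS)⟩
  | diaE_major _ ih =>
    cases h with | diaE ht hu hγ hi he =>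
    obtain ⟨h1, h2, h3, h4⟩ := ih ht
    exact ⟨.diaE_major h1, .diaE h2 hu hγ hi he,
      append_subset_append h3 (List.Subset.refl _),
      fun hS => append_subset_append (h4 hS) (List.Subset.refl _)⟩
  | diaE_minor _ ih =>
    cases h with | diaE ht hu hγ hi he =>
    obtain ⟨h1, h2, h3, h4⟩ := ih hu
    exact ⟨.diaE_minor h1, .diaE ht h2 hγ (fun p hp => hi p (discharge_subset h3 hp))
      (fun hS ε hε => he hS ε (h4 hS hε)),
      append_subset_append (List.Subset.refl _) (discharge_subset h3),
      fun hS => append_subset_append (List.Subset.refl _) (List.filter_subset _ (h4 hS))⟩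

/-- A loose reduction of trees that starts in a deduction is a reduction of deductions. -/
theorem Deduction.exists_reduces (P : Deduction S Γ Ξ a) (h : Steps P.1 t') :
    ∃ Q : Deduction S Γ Ξ a, P.Reduces Q ∧ Q.1 = t' := by
  induction h with
  | refl => exact ⟨P, .refl, rfl⟩
  | tail _ hs ih =>
    obtain ⟨Q, hQ, rfl⟩ := ih
    obtain ⟨h1, h2⟩ := hs.refines Q.2
    exact ⟨⟨_, h2.isDeduction⟩, hQ.tail h1, rfl⟩

end
end PosND

theorem mainTheorem1 (S : PosND.System) (Γ : List PosND.PForm) (Ξ : List PosND.Pos)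
    (a : PosND.PForm) (P : PosND.Deduction S Γ Ξ a) :
    ∃ Q : PosND.Deduction S Γ Ξ a, P.Reduces Q ∧ Q.IsNormal := by
  obtain ⟨t, h1, h2, -⟩ := P.2.typed.normalizes
  obtain ⟨Q, hQ, rfl⟩ := P.exists_reduces h1
  exact ⟨Q, hQ, h2.not_step⟩
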